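/- Let $N\in\mathbb N$ and let $\Omega\subset\mathbb R^N$ be the closure of a nonempty bounded connected open set with smooth boundary; let $\nu_\Omega$ be its outer unit normal. Let $1<p<\infty$ and $q=p/(p-1)$. Let $\dot W^{1,q}(\Omega)$ be the quotient of the Sobolev space $W^{1,q}(\Omega)$ by the functions that are a.e. constant, normed by $\|u\|_{\dot W^{1,q}(\Omega)}=\left(\int_\Omega|\nabla u|^q\,dx\right)^{1/q}$, let $\dot W^{-1,p}(\Omega)$ be its dual space, and let $T\in\dot W^{-1,p}(\Omega)$. A vector field $V\in L^p(\Omega;\mathbb R^N)$ is said to satisfy $-\mathrm{div}\,V=T$ in $\Omega$, $V\cdot\nu_\Omega=0$ on $\partial\Omega$, if $$\int_\Omega\nabla\varphi\cdot V\,dx=\langle T,\varphi\rangle\qquad\text{for every }\varphi\in C^1(\Omega),$$ where $C^1(\Omega)$ is the set of restrictions to $\Omega$ of $C^1$ functions on $\mathbb R^N$. Let $\mathcal H:\Omega\times\mathbb R^N\to\mathbb R$ be a Carathéodory function such that $z\mapsto\mathcal H(x,z)$ is convex for every $x\in\Omega$, and such that for some $0<\lambda\le1$ $$\lambda(|z|^p-1)\le\mathcal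 H(x,z)\le\frac1\lambda(|z|^p+1)\qquad\text{for all }(x,z)\in\Omega\times\mathbb R^N.$$ Assume in addition that for every $x\in\Omega$ the function $z\mapsto\mathcal H(x,z)$ is a strictly convex increasing function of $|z|$, i.e. $\mathcal H(x,z)=h_x(|z|)$ for some strictly convex increasing $h_x:[0,\infty)\to\mathbb R$. Then the problem $$\min_{V\in L^p(\Omega;\mathbb R^N)}\left\{\int_\Omega\mathcal H(x,V)\,dx\,:\,-\mathrm{div}\,V=T\text{ in }\Omega,\ V\cdot\nu_\Omega=0\text{ on }\partial\Omega\right\}$$ has a unique minimizer $V$ (with finite energy, and unique up to equality a.e.), and $V$ is acyclic: $V\in L^1(\Omega;\mathbb R^N)$, and whenever $V=V_1+V_2$ a.e. with $V_1,V_2\in L^1(\Omega;\mathbb R^N)$, $|V|=|V_1|+|V_2|$ a.e., and $\int_\Omega V_1\cdot\nabla\varphi\,dx=0$ for every $\varphi\in C^1(\Omega)$, one has $V_1=0$ a.e. in $\Omega$. -/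

import Mathlib

open MeasureTheory TopologicalSpace Set
open scoped ENNReal Topology Gradient ContDiff RealInnerProductSpace

noncomputable section

namespace Beckmann

/-- The Euclidean space `ℝ^N`. -/
abbrev Euc (N : ℕ) : Type := EuclideanSpace ℝ (Fin N)

variable {N : ℕ}

/-- The open set `U` has smooth boundary: near each boundary point it is the sublevel set
`{ρ < 0}` of a smooth function with nonvanishing differential at that point. -/
def HasSmoothBoundary (U : Set (Euc N)) : Prop :=
  ∀ x ∈ frontier U, ∃ (W : Set (Euc N)) (ρ : Euc N → ℝ), IsOpen W ∧ x ∈ W ∧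
    ContDiffOn ℝ ∞ ρ W ∧ fderiv ℝ ρ x ≠ 0 ∧ U ∩ W = {y ∈ W | ρ y < 0}

/-- `Ω` is the closure of a (nonempty) bounded connected open set with smooth boundary. -/
def IsClosedSmoothDomain (Ω : Set (Euc N)) : Prop :=
  ∃ U : Set (Euc N), IsOpen U ∧ Bornology.IsBounded U ∧ IsConnected U ∧
    HasSmoothBoundary U ∧ Ω = closure U

/-- Lebesgue measure on `Ω`. -/
abbrev leb (Ω : Compacts (Euc N)) : Measure (Euc N) := volume.restrict (Ω : Set (Euc N))

instance (Ω : Compacts (Euc N)) : IsFiniteMeasure (leb Ω) :=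
  ⟨by simpa using Ω.isCompact.measure_lt_top⟩

/-- `g` is the distributional gradient of `u` in the interior of `Ω`:
`∫ u ∇ψ = - ∫ ψ g` for all smooth `ψ` with compact support in the interior. -/
def HasWeakGradient (Ω : Compacts (Euc N)) (u : Euc N → ℝ) (g : Euc N → Euc N) : Prop :=
  ∀ ψ : Euc N → ℝ, ContDiff ℝ ∞ ψ → HasCompactSupport ψ →
    tsupport ψ ⊆ interior (Ω : Set (Euc N)) →
    ∫ x, u x • ∇ ψ x ∂(leb Ω) = - ∫ x, ψ x • g x ∂(leb Ω)

theorem continuous_gradient {φ : Euc N → ℝ} (hφ : ContDiff ℝ 1 φ) : Continuous (∇ φ) := by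
  unfold gradient
  exact (LinearIsometryEquiv.continuous _).comp (hφ.continuous_fderiv one_ne_zero)

theorem hasCompactSupport_gradient {ψ : Euc N → ℝ} (hc : HasCompactSupport ψ) :
    HasCompactSupport (∇ ψ) := by
  have h := hc.fderiv (𝕜 := ℝ)
  unfold gradient
  exact h.comp_left (g := (InnerProductSpace.toDual ℝ (Euc N)).symm) (map_zero _)

theorem memLp_of_continuous {F : Type*} [NormedAddCommGroup F] [SecondCountableTopology F]
    (Ω : Compacts (Euc N)) (q : ℝ≥0∞) {f : Euc N → F} (hf : Continuous f) :
    MemLp f q (leb Ω) := by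
  obtain ⟨C, hC⟩ := Ω.isCompact.exists_bound_of_continuousOn hf.continuousOn
  refine MemLp.of_bound hf.aestronglyMeasurable C ?_
  exact (ae_restrict_iff' Ω.isCompact.measurableSet).2 (Filter.Eventually.of_forall hC)

theorem integrable_smul_of_bounded {q : ℝ≥0∞} [Fact (1 ≤ q)] {Ω : Compacts (Euc N)}
    {F : Type*} [NormedAddCommGroup F] [NormedSpace ℝ F] [SecondCountableTopology F]
    {u : Euc N → ℝ} {f : Euc N → F} (hu : MemLp u q (leb Ω)) (hf : Continuous f) :
    Integrable (fun x => u x • f x) (leb Ω) := by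
  have h1 : MemLp u 1 (leb Ω) := hu.mono_exponent Fact.out
  exact memLp_one_iff_integrable.1 ((memLp_of_continuous Ω ∞ hf).smul h1)

theorem integrable_smul_of_bounded' {q : ℝ≥0∞} [Fact (1 ≤ q)] {Ω : Compacts (Euc N)}
    {F : Type*} [NormedAddCommGroup F] [NormedSpace ℝ F]
    {ψ : Euc N → ℝ} {g : Euc N → F} (hψ : Continuous ψ) (hg : MemLp g q (leb Ω)) :
    Integrable (fun x => ψ x • g x) (leb Ω) := by
  have h1 : MemLp g 1 (leb Ω) := hg.mono_exponent Fact.out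
  exact memLp_one_iff_integrable.1 (h1.smul (memLp_of_continuous Ω ∞ hψ))

/-- A `C¹` function has its classical gradient as distributional gradient. -/
theorem hasWeakGradient_of_contDiff (Ω : Compacts (Euc N)) {φ : Euc N → ℝ}
    (hφ : ContDiff ℝ 1 φ) : HasWeakGradient Ω φ (∇ φ) := by
  intro ψ hψ hc hs
  have hψ1 : ContDiff ℝ 1 ψ := hψ.of_le (by exact_mod_cast le_top)
  have hsub : ∀ x, x ∉ (Ω : Set (Euc N)) → x ∉ tsupport ψ :=
    fun x hx h => hx (interior_subset (hs h))
  have e1 : ∫ x, φ x • ∇ ψ x ∂(leb Ω) = ∫ x, φ x • ∇ ψ x := by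
    refine setIntegral_eq_integral_of_forall_compl_eq_zero fun x hx => ?_
    have h0 : fderiv ℝ ψ x = 0 := by
      by_contra h
      exact hsub x hx (support_fderiv_subset ℝ h)
    simp [gradient, h0]
  have e2 : ∫ x, ψ x • ∇ φ x ∂(leb Ω) = ∫ x, ψ x • ∇ φ x := by
    refine setIntegral_eq_integral_of_forall_compl_eq_zero fun x hx => ?_
    simp [image_eq_zero_of_notMem_tsupport (hsub x hx)]
  rw [e1, e2]
  have cg := continuous_gradient hψ1
  have cf := continuous_gradient hφ
  have i1 : Integrable (fun x => φ x • ∇ ψ x) :=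
    (hφ.continuous.smul cg).integrable_of_hasCompactSupport
      ((hasCompactSupport_gradient hc).smul_left)
  have i2 : Integrable (fun x => ψ x • ∇ φ x) :=
    (hψ1.continuous.smul cf).integrable_of_hasCompactSupport hc.smul_right
  have i3 : Integrable (fun x => φ x * ψ x) :=
    (hφ.continuous.mul hψ1.continuous).integrable_of_hasCompactSupport hc.mul_left
  have hin : ∀ (f : Euc N → ℝ) (x v : Euc N), ⟪v, ∇ f x⟫ = fderiv ℝ f x v := by
    intro f x v
    rw [real_inner_comm]
    simp [gradient]
  refine ext_inner_left ℝ fun v => ?_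
  rw [inner_neg_right, ← integral_inner i1, ← integral_inner i2]
  simp only [inner_smul_right, hin]
  have j1 := i1.const_inner (𝕜 := ℝ) v
  have j2 := i2.const_inner (𝕜 := ℝ) v
  simp only [inner_smul_right, hin] at j1 j2
  have := integral_mul_fderiv_eq_neg_fderiv_mul_of_integrable (𝕜 := ℝ) (μ := volume)
    (f := φ) (g := ψ) (v := v) (by simpa [mul_comm] using j2) j1 i3
    (fun x _ => (hφ.differentiable one_ne_zero) x)
    (fun x _ => (hψ1.differentiable one_ne_zero) x)
  rw [this]
  simp [mul_comm]

section Sobolev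

variable (Ω : Compacts (Euc N)) (q : ℝ≥0∞) [Fact (1 ≤ q)]

/-- The Sobolev space `W^{1,q}(Ω)`, realised as the space of pairs `(u, ∇u)` with `u ∈ L^q(Ω)`
and distributional gradient `∇u ∈ L^q(Ω; ℝ^N)`. -/
def Sobolev : Submodule ℝ (Lp ℝ q (leb Ω) × Lp (Euc N) q (leb Ω)) where
  carrier := {w | HasWeakGradient Ω w.1 w.2}
  zero_mem' := by
    intro ψ _ _ _
    have h1 : ∫ x, ((0 : Lp ℝ q (leb Ω)) : Euc N → ℝ) x • ∇ ψ x ∂(leb Ω) = 0 := by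
      refine integral_eq_zero_of_ae ?_
      filter_upwards [Lp.coeFn_zero ℝ q (leb Ω)] with x hx
      rw [hx, Pi.zero_apply, zero_smul, Pi.zero_apply]
    have h2 : ∫ x, ψ x • ((0 : Lp (Euc N) q (leb Ω)) : Euc N → Euc N) x ∂(leb Ω) = 0 := by
      refine integral_eq_zero_of_ae ?_
      filter_upwards [Lp.coeFn_zero (Euc N) q (leb Ω)] with x hx
      rw [hx, Pi.zero_apply, smul_zero]
    simp only [Prod.fst_zero, Prod.snd_zero, h1, h2, neg_zero]
  add_mem' := by
    intro a b ha hb ψ h1 h2 h3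
    have hψ1 : ContDiff ℝ 1 ψ := h1.of_le (by exact_mod_cast le_top)
    have cg := continuous_gradient hψ1
    have e1 : ∫ x, (a + b).1 x • ∇ ψ x ∂(leb Ω)
        = ∫ x, (a.1 x • ∇ ψ x + b.1 x • ∇ ψ x) ∂(leb Ω) := by
      refine integral_congr_ae ?_
      filter_upwards [Lp.coeFn_add a.1 b.1] with x hx
      rw [Prod.fst_add, hx, Pi.add_apply, add_smul]
    have e2 : ∫ x, ψ x • (a + b).2 x ∂(leb Ω)
        = ∫ x, (ψ x • a.2 x + ψ x • b.2 x) ∂(leb Ω) := by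
      refine integral_congr_ae ?_
      filter_upwards [Lp.coeFn_add a.2 b.2] with x hx
      rw [Prod.snd_add, hx, Pi.add_apply, smul_add]
    rw [e1, e2, integral_add (integrable_smul_of_bounded (Lp.memLp a.1) cg)
      (integrable_smul_of_bounded (Lp.memLp b.1) cg),
      integral_add (integrable_smul_of_bounded' hψ1.continuous (Lp.memLp a.2))
      (integrable_smul_of_bounded' hψ1.continuous (Lp.memLp b.2)),
      ha ψ h1 h2 h3, hb ψ h1 h2 h3, neg_add]
  smul_mem' := by
    intro c a ha ψ h1 h2 h3
    have e1 : ∫ x, (c • a).1 x • ∇ ψ x ∂(leb Ω) = ∫ x, c • (a.1 x • ∇ ψ x) ∂(leb Ω) := by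
      refine integral_congr_ae ?_
      filter_upwards [Lp.coeFn_smul c a.1] with x hx
      rw [Prod.smul_fst, hx, Pi.smul_apply, smul_assoc]
    have e2 : ∫ x, ψ x • (c • a).2 x ∂(leb Ω) = ∫ x, c • (ψ x • a.2 x) ∂(leb Ω) := by
      refine integral_congr_ae ?_
      filter_upwards [Lp.coeFn_smul c a.2] with x hx
      rw [Prod.smul_snd, hx, Pi.smul_apply, smul_comm]
    rw [e1, e2, integral_smul, integral_smul, ha ψ h1 h2 h3, smul_neg]

/-- The gradient `W^{1,q}(Ω) → L^q(Ω; ℝ^N)`. -/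
def Sobolev.grad : Sobolev Ω q →ₗ[ℝ] Lp (Euc N) q (leb Ω) :=
  (LinearMap.snd ℝ _ _).comp (Sobolev Ω q).subtype

/-- The functions in `W^{1,q}(Ω)` that are a.e. equal to a constant (the pairs `(c, 0)`). -/
def Sobolev.constants : Submodule ℝ (Sobolev Ω q) where
  carrier := {w | (∃ c : ℝ, ∀ᵐ x ∂(leb Ω), w.1.1 x = c) ∧ Sobolev.grad Ω q w = 0}
  zero_mem' := ⟨⟨0, by
    filter_upwards [Lp.coeFn_zero ℝ q (leb Ω)] with x hx
    simpa using hx⟩, map_zero _⟩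
  add_mem' := by
    rintro a b ⟨⟨c, hc⟩, ha⟩ ⟨⟨d, hd⟩, hb⟩
    refine ⟨⟨c + d, ?_⟩, by rw [map_add, ha, hb, add_zero]⟩
    filter_upwards [hc, hd, Lp.coeFn_add a.1.1 b.1.1] with x h1 h2 h3
    rw [← h1, ← h2]
    exact h3
  smul_mem' := by
    rintro r a ⟨⟨c, hc⟩, ha⟩
    refine ⟨⟨r * c, ?_⟩, by rw [map_smul, ha, smul_zero]⟩
    filter_upwards [hc, Lp.coeFn_smul r a.1.1] with x h1 h2
    rw [← h1]
    exact h2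

/-- The quotient `W^{1,q}(Ω) / ∼`, where functions differing by a constant are identified. -/
def HomSobolev : Type := Sobolev Ω q ⧸ Sobolev.constants Ω q

instance : AddCommGroup (HomSobolev Ω q) :=
  inferInstanceAs (AddCommGroup (Sobolev Ω q ⧸ Sobolev.constants Ω q))

instance : Module ℝ (HomSobolev Ω q) :=
  inferInstanceAs (Module ℝ (Sobolev Ω q ⧸ Sobolev.constants Ω q))

/-- The class of an element of `W^{1,q}(Ω)` modulo constants. -/
def HomSobolev.mk : Sobolev Ω q →ₗ[ℝ] HomSobolev Ω q := (Sobolev.constants Ω q).mkQ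

/-- The gradient, which does not depend on the representative. -/
def HomSobolev.grad : HomSobolev Ω q →ₗ[ℝ] Lp (Euc N) q (leb Ω) :=
  (Sobolev.constants Ω q).liftQ (Sobolev.grad Ω q) fun _ hw => LinearMap.mem_ker.2 hw.2

/-- The norm of the quotient space is `‖u‖ = ‖∇u‖_{L^q}`. -/
instance : SeminormedAddCommGroup (HomSobolev Ω q) :=
  SeminormedAddCommGroup.induced _ _ (HomSobolev.grad Ω q)

instance : NormedSpace ℝ (HomSobolev Ω q) :=
  NormedSpace.induced ℝ _ _ (HomSobolev.grad Ω q)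

theorem HomSobolev.norm_mk (w : Sobolev Ω q) : ‖HomSobolev.mk Ω q w‖ = ‖w.1.2‖ := rfl

/-- The (restriction to `Ω` of the) `C¹` function `φ` as an element of `W^{1,q}(Ω)`. -/
def Sobolev.ofC1 (φ : Euc N → ℝ) (hφ : ContDiff ℝ 1 φ) : Sobolev Ω q :=
  ⟨((memLp_of_continuous Ω q hφ.continuous).toLp φ,
    (memLp_of_continuous Ω q (continuous_gradient hφ)).toLp (∇ φ)), by
    intro ψ h1 h2 h3
    have h := hasWeakGradient_of_contDiff Ω hφ ψ h1 h2 h3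
    have e1 : ∫ x, ((memLp_of_continuous Ω q hφ.continuous).toLp φ) x • ∇ ψ x ∂(leb Ω)
        = ∫ x, φ x • ∇ ψ x ∂(leb Ω) := by
      refine integral_congr_ae ?_
      filter_upwards [(memLp_of_continuous Ω q hφ.continuous).coeFn_toLp] with x hx
      rw [hx]
    have e2 : ∫ x, ψ x • ((memLp_of_continuous Ω q (continuous_gradient hφ)).toLp (∇ φ)) x
        ∂(leb Ω) = ∫ x, ψ x • ∇ φ x ∂(leb Ω) := by
      refine integral_congr_ae ?_
      filter_upwards [(memLp_of_continuous Ω q (continuous_gradient hφ)).coeFn_toLp] with x hx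
      rw [hx]
    exact e1.trans (h.trans (congrArg Neg.neg e2.symm))⟩

/-- The class of a `C¹` function modulo constants. -/
def HomSobolev.ofC1 (φ : Euc N → ℝ) (hφ : ContDiff ℝ 1 φ) : HomSobolev Ω q :=
  HomSobolev.mk Ω q (Sobolev.ofC1 Ω q φ hφ)

/-- The dual Sobolev space `W^{-1,p}(Ω)` (homogeneous), for the exponent `p` conjugate to `q`. -/
abbrev DualSobolev : Type := StrongDual ℝ (HomSobolev Ω q)

end Sobolev

/-- `-div V = T` in `Ω` and `V · ν = 0` on `∂Ω`, in the weak sense: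
`∫_Ω ∇φ · V = ⟨T, φ⟩` for all `φ ∈ C¹(Ω)`. -/
def IsAdmissible (Ω : Compacts (Euc N)) (q : ℝ≥0∞) [Fact (1 ≤ q)] (T : DualSobolev Ω q)
    (V : Euc N → Euc N) : Prop :=
  ∀ (φ : Euc N → ℝ) (hφ : ContDiff ℝ 1 φ),
    ∫ x, ⟪∇ φ x, V x⟫ ∂(leb Ω) = T (HomSobolev.ofC1 Ω q φ hφ)

/-- `H : Ω × ℝ^N → ℝ` is a Carathéodory function. -/
def IsCaratheodory (Ω : Compacts (Euc N)) (H : Euc N → Euc N → ℝ) : Prop :=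
  (∀ z, AEMeasurable (fun x => H x z) (leb Ω)) ∧ ∀ᵐ x ∂(leb Ω), Continuous (H x)

/-- The growth condition of order `p`. -/
def HasGrowth (Ω : Compacts (Euc N)) (p : ℝ) (H : Euc N → Euc N → ℝ) : Prop :=
  ∃ c : ℝ, 0 < c ∧ c ≤ 1 ∧ ∀ x ∈ Ω, ∀ z : Euc N,
    c * (‖z‖ ^ p - 1) ≤ H x z ∧ H x z ≤ (1 / c) * (‖z‖ ^ p + 1)

/-- `z ↦ H(x, z)` is a strictly convex increasing function of `|z|`, for every `x ∈ Ω`. -/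
def IsStrictlyConvexIncreasingInNorm (Ω : Compacts (Euc N)) (H : Euc N → Euc N → ℝ) : Prop :=
  ∀ x ∈ Ω, ∃ h : ℝ → ℝ, StrictConvexOn ℝ (Ici 0) h ∧ MonotoneOn h (Ici 0) ∧
    ∀ z : Euc N, H x z = h ‖z‖

/-- `V ∈ L^p(Ω; ℝ^N)` is a minimizer, with finite energy, of `∫_Ω H(x, V) dx` among all
`V ∈ L^p(Ω; ℝ^N)` with `-div V = T`, `V · ν = 0`. -/
def IsBeckmannMinimizer (Ω : Compacts (Euc N)) (p q : ℝ≥0∞) [Fact (1 ≤ q)]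
    (H : Euc N → Euc N → ℝ) (T : DualSobolev Ω q) (V : Lp (Euc N) p (leb Ω)) : Prop :=
  IsAdmissible Ω q T V ∧ Integrable (fun x => H x (V x)) (leb Ω) ∧
    ∀ W : Lp (Euc N) p (leb Ω), IsAdmissible Ω q T W →
      ∫ x, H x (V x) ∂(leb Ω) ≤ ∫ x, H x (W x) ∂(leb Ω)

/-- Acyclicity of a vector field `V ∈ L¹(Ω; ℝ^N)`: if `V = V₁ + V₂` with `|V| = |V₁| + |V₂|` and
`div V₁ = 0` with homogeneous Neumann condition, then `V₁ = 0`. -/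
def IsAcyclic (Ω : Compacts (Euc N)) (V : Euc N → Euc N) : Prop :=
  Integrable V (leb Ω) ∧
  ∀ V₁ V₂ : Euc N → Euc N, Integrable V₁ (leb Ω) → Integrable V₂ (leb Ω) →
    (∀ᵐ x ∂(leb Ω), V x = V₁ x + V₂ x) →
    (∀ᵐ x ∂(leb Ω), ‖V x‖ = ‖V₁ x‖ + ‖V₂ x‖) →
    (∀ φ : Euc N → ℝ, ContDiff ℝ 1 φ → ∫ x, ⟪V₁ x, ∇ φ x⟫ ∂(leb Ω) = 0) →
    ∀ᵐ x ∂(leb Ω), V₁ x = 0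

end Beckmann

end

namespace Beckmann

/-! ### Densities of functionals on `L^q` via Radon–Nikodym. -/

section Riesz

open Filter

variable {α : Type*} [MeasurableSpace α] {μ : Measure α} [IsFiniteMeasure μ]

/-! Existence is the direct method, with weak compactness replaced by an almost everywhere
selection. An admissible field exists because `T` depends only on the gradient: Hahn–Banach extends
it to all of `L^q(Ω; ℝ^N)`, and Riesz representation, proved here from Radon–Nikodym, turns the
extension into a field in `L^p`.

The near-minimizers of the energy, at levels decreasing to the infimum, form nested nonempty sets
stable under midpoints and bounded in `L^p`. Nearly minimizing in them the auxiliary strictly convex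
functional `∫ √(1 + |v|²)` makes consecutive choices so close that they converge a.e.
(`exists_mem_ae_tendsto`). Fatou's lemma (`integral_le_of_tendsto_ae`) then makes the energy lower
semicontinuous. It also passes the divergence constraint to the limit
(`IsAdmissible.of_tendsto_ae`), since `δ|v|^p` absorbs the linear term `⟪∇φ, v⟫` when `p > 1`.

Uniqueness is strict convexity: a strictly convex increasing function of the Euclidean norm is
strictly convex. For acyclicity, removing the divergence-free part `V₁` leaves `V₂` admissible with
`|V₂| ≤ |V|`, hence with no larger energy; uniqueness forces `V₂ = V`, so `V₁ = 0`. -/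

theorem tendsto_measure_biUnion_symmDiff_iUnion {f : ℕ → Set α} (hf : ∀ i, MeasurableSet (f i))
    (hd : Pairwise (Function.onFun Disjoint f)) :
    Tendsto (fun s : Finset ℕ => μ (symmDiff (⋃ i ∈ s, f i) (⋃ i, f i))) atTop (𝓝 0) := by
  have hfin : ∑' i, μ (f i) ≠ ⊤ := by
    rw [← measure_iUnion hd hf]
    exact measure_ne_top _ _
  refine tendsto_of_tendsto_of_tendsto_of_le_of_le tendsto_const_nhds
    (ENNReal.tendsto_tsum_compl_atTop_zero hfin) (fun _ => zero_le) fun s => ?_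
  refine (measure_mono ?_).trans (measure_iUnion_le fun b : {x // x ∉ s} => f b)
  rintro x (⟨h1, h2⟩ | ⟨h1, h2⟩)
  · simp only [mem_iUnion] at h1 h2
    obtain ⟨i, _, hi⟩ := h1
    exact absurd ⟨i, hi⟩ h2
  · simp only [mem_iUnion] at h1 h2 ⊢
    obtain ⟨i, hi⟩ := h1
    exact ⟨⟨i, fun his => h2 ⟨i, his, hi⟩⟩, hi⟩

theorem sum_indicatorConstLp {q : ℝ≥0∞} {f : ℕ → Set α} (hf : ∀ i, MeasurableSet (f i))
    (hd : Pairwise (Function.onFun Disjoint f)) (s : Finset ℕ) :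
    ∑ i ∈ s, indicatorConstLp q (hf i) (measure_ne_top μ _) (1 : ℝ)
      = indicatorConstLp q (s.measurableSet_biUnion fun i _ => hf i) (measure_ne_top μ _) 1 := by
  induction s using Finset.induction_on with
  | empty => simp
  | insert a s ha ih =>
    rw [Finset.sum_insert ha, ih]
    have hdis : Disjoint (f a) (⋃ i ∈ s, f i) := by
      simp only [disjoint_iUnion_right]
      exact fun i hi => hd fun h => ha (h ▸ hi)
    rw [← indicatorConstLp_disjoint_union (hf a) (s.measurableSet_biUnion fun i _ => hf i)
      (measure_ne_top μ _) (measure_ne_top μ _) hdis]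
    congr 1
    simp

open Classical in
/-- The signed measure `A ↦ ℓ(1_A)` attached to a continuous functional `ℓ` on `L^q`. -/
noncomputable def signedMeasureOfDual {q : ℝ≥0∞} [Fact (1 ≤ q)] (hq : q ≠ ⊤)
    (l : StrongDual ℝ (Lp ℝ q μ)) : SignedMeasure α where
  measureOf' A := if hA : MeasurableSet A then
    l (indicatorConstLp q hA (measure_ne_top μ _) 1) else 0
  empty' := by simp
  not_measurable' A hA := by simp [hA]
  m_iUnion' f hf hd := by
    simp only [hf, MeasurableSet.iUnion hf, dif_pos]
    -- Countable additivity: for `q < ∞` the indicators of the finite unions converge in `L^q` to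
    -- that of the whole union, and `l` is continuous.
    have h := (l.continuous.tendsto _).comp
      (tendsto_indicatorConstLp_set (c := (1 : ℝ)) (hs := MeasurableSet.iUnion hf)
        (hμs := measure_ne_top μ _) (ht := fun s : Finset ℕ => s.measurableSet_biUnion fun i _ => hf i)
        (hμt := fun _ => measure_ne_top μ _) hq (tendsto_measure_biUnion_symmDiff_iUnion hf hd))
    refine h.congr fun s => ?_
    rw [Function.comp_apply, ← sum_indicatorConstLp hf hd, map_sum]

/-- An indicator of a null set vanishes in `L^q`, so the signed measure of `l` is absolutely
continuous and `g` is its Radon–Nikodym derivative. At this stage `g` is only known to be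
integrable. -/
theorem exists_density_of_dual {q : ℝ≥0∞} [Fact (1 ≤ q)] (hq : q ≠ ⊤)
    (l : StrongDual ℝ (Lp ℝ q μ)) :
    ∃ g : α → ℝ, Measurable g ∧ Integrable g μ ∧ ∀ s : SimpleFunc α ℝ,
      l ((s.memLp_of_isFiniteMeasure q μ).toLp s) = ∫ x, s x * g x ∂μ := by
  set ν := signedMeasureOfDual hq l with hν
  have hν' : ∀ A (hA : MeasurableSet A), ν A = l (indicatorConstLp q hA (measure_ne_top μ _) 1) :=
    fun A hA => dif_pos hA
  have hac : ν.AbsolutelyContinuous μ.toENNRealVectorMeasure := by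
    intro A hA
    by_cases hm : MeasurableSet A
    · rw [Measure.toENNRealVectorMeasure_apply_measurable hm] at hA
      rw [hν' A hm]
      have : indicatorConstLp q hm (measure_ne_top μ _) (1 : ℝ) = 0 := by
        refine norm_eq_zero.1 ?_
        rw [norm_indicatorConstLp (one_pos.trans_le Fact.out).ne' hq]
        simp only [measureReal_def, hA, ENNReal.toReal_zero, norm_one, one_mul]
        refine Real.zero_rpow (one_div_ne_zero ?_)
        exact (ENNReal.toReal_pos (one_pos.trans_le (Fact.out : 1 ≤ q)).ne' hq).ne'
      rw [this, map_zero]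
    · exact ν.not_measurable hm
  have hrn := SignedMeasure.withDensityᵥ_rnDeriv_eq ν μ hac
  have hint : Integrable (ν.rnDeriv μ) μ := SignedMeasure.integrable_rnDeriv _ _
  have hmul : ∀ s : SimpleFunc α ℝ, Integrable (fun x => s x * ν.rnDeriv μ x) μ := fun s => by
    obtain ⟨C, hC⟩ := s.exists_forall_norm_le
    exact hint.bdd_mul s.aestronglyMeasurable (ae_of_all _ hC)
  refine ⟨ν.rnDeriv μ, SignedMeasure.measurable_rnDeriv _ _, hint, fun s => ?_⟩
  induction s using SimpleFunc.induction with
  | const c hs =>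
    rename_i A
    have e : ((SimpleFunc.piecewise A hs (SimpleFunc.const _ c)
        (SimpleFunc.const _ 0)).memLp_of_isFiniteMeasure q μ).toLp _
        = c • indicatorConstLp q hs (measure_ne_top μ _) (1 : ℝ) := by
      refine Lp.ext ?_
      refine (MemLp.coeFn_toLp _).trans ?_
      filter_upwards [Lp.coeFn_smul c (indicatorConstLp q hs (measure_ne_top μ _) (1 : ℝ)),
        indicatorConstLp_coeFn (p := q) (hs := hs) (hμs := measure_ne_top μ _) (c := (1:ℝ))]
        with x h1 h2
      rw [h1, Pi.smul_apply, h2]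
      by_cases hx : x ∈ A <;> simp [hx]
    rw [e, map_smul, ← hν' A hs, ← hrn, withDensityᵥ_apply hint hs, smul_eq_mul, hrn,
      ← integral_const_mul, ← integral_indicator hs]
    congr 1
    ext x
    by_cases hx : x ∈ A <;> simp [hx]
  | add hd h1 h2 =>
    rename_i f g
    have e : ((f + g).memLp_of_isFiniteMeasure q μ).toLp ⇑(f + g)
        = (f.memLp_of_isFiniteMeasure q μ).toLp f + (g.memLp_of_isFiniteMeasure q μ).toLp g := rfl
    rw [e, map_add, h1, h2, ← integral_add (hmul f) (hmul g)]
    congr 1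
    ext x
    simp [add_mul]

end Riesz

/-! ### Integrability of the density and scalar Riesz representation. -/

section Riesz

open Filter

variable {α : Type*} [MeasurableSpace α] {μ : Measure α}

/-- Fatou's lemma for the `L^p` norm, with the bound kept explicit. -/
theorem memLp_of_tendsto_ae_of_integral_rpow_le {F : Type*} [NormedAddCommGroup F] {p : ℝ≥0∞}
    (hp : p ≠ 0) (hp' : p ≠ ⊤) {B : ℝ} {f : ℕ → α → F} {g : α → F} (hf : ∀ n, MemLp (f n) p μ)
    (hB : ∀ n, ∫ x, ‖f n x‖ ^ p.toReal ∂μ ≤ B)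
    (h : ∀ᵐ x ∂μ, Tendsto (fun n => f n x) atTop (𝓝 (g x))) :
    MemLp g p μ ∧ ∫ x, ‖g x‖ ^ p.toReal ∂μ ≤ B := by
  have hpos : 0 < p.toReal := ENNReal.toReal_pos hp hp'
  have hB0 : 0 ≤ B := (integral_nonneg fun x => by positivity).trans (hB 0)
  have hg : AEStronglyMeasurable g μ := aestronglyMeasurable_of_tendsto_ae _ (fun n => (hf n).1) h
  have hle : eLpNorm g p μ ≤ ENNReal.ofReal (B ^ p.toReal⁻¹) := by
    refine (Lp.eLpNorm_lim_le_liminf_eLpNorm (fun n => (hf n).1) g h).trans ?_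
    refine (liminf_le_liminf (v := fun _ => ENNReal.ofReal (B ^ p.toReal⁻¹))
      (Eventually.of_forall fun n => ?_)).trans (liminf_const _).le
    rw [(hf n).eLpNorm_eq_integral_rpow_norm hp hp']
    refine ENNReal.ofReal_le_ofReal (Real.rpow_le_rpow (integral_nonneg fun x => by positivity)
      (hB n) (by positivity))
  have hm : MemLp g p μ := ⟨hg, hle.trans_lt ENNReal.ofReal_lt_top⟩
  refine ⟨hm, ?_⟩
  rw [hm.eLpNorm_eq_integral_rpow_norm hp hp', ENNReal.ofReal_le_ofReal_iff (by positivity)] at hle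
  exact (Real.rpow_le_rpow_iff (integral_nonneg fun x => by positivity) hB0
    (inv_pos.2 hpos)).1 hle

variable [IsFiniteMeasure μ]

/-- The converse of Hölder's inequality. Approximating `|g|` from below by simple functions `a n`
keeps every integral finite, so that a power of it can be cancelled; Fatou then removes the
approximation. -/
theorem memLp_of_integral_simpleFunc_mul_le {p q : ℝ≥0∞} (hp : 1 < p) (hp' : p < ⊤)
    (hpq : p.HolderConjugate q) {g : α → ℝ} (hg : Measurable g)
    (hgi : Integrable g μ) {K : ℝ} (hK : 0 ≤ K)
    (h : ∀ s : SimpleFunc α ℝ, ∫ x, s x * g x ∂μ ≤ K * (∫ x, ‖s x‖ ^ q.toReal ∂μ) ^ q.toReal⁻¹) :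
    MemLp g p μ := by
  have hP : 1 < p.toReal := by
    simpa using (ENNReal.toReal_lt_toReal ENNReal.one_ne_top hp'.ne).2 hp
  have hPQ : p.toReal.HolderConjugate q.toReal := ENNReal.HolderConjugate.toReal hP
  have hp0 : p ≠ 0 := (zero_lt_one.trans hp).ne'
  set e : α → ℝ≥0∞ := fun x => ‖g x‖ₑ with he
  have hem : Measurable e := hg.enorm
  let a : ℕ → SimpleFunc α ℝ := fun n => (SimpleFunc.eapprox e n).map ENNReal.toReal
  have ha0 : ∀ n x, 0 ≤ a n x := fun n x => ENNReal.toReal_nonneg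
  have hag : ∀ n x, a n x ≤ |g x| := by
    intro n x
    have h1 : SimpleFunc.eapprox e n x ≤ e x := by
      rw [← SimpleFunc.iSup_eapprox_apply hem x]
      exact le_iSup (fun k => SimpleFunc.eapprox e k x) n
    have := ENNReal.toReal_mono (by simp [he]) h1
    simpa [a, he] using this
  have hat : ∀ x, Tendsto (fun n => a n x) atTop (𝓝 ‖g x‖) := by
    intro x
    have := (ENNReal.tendsto_toReal (by simp [he] : e x ≠ ⊤)).comp
      (SimpleFunc.tendsto_eapprox hem x)
    simpa [he, Function.comp_def, a] using this
  have hpos : MeasurableSet {x | 0 ≤ g x} := measurableSet_le measurable_const hg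
  let sg : SimpleFunc α ℝ := SimpleFunc.piecewise {x | 0 ≤ g x} hpos (SimpleFunc.const _ 1)
    (SimpleFunc.const _ (-1))
  have hsg : ∀ x, sg x * g x = |g x| ∧ |sg x| = 1 := by
    intro x
    by_cases hx : 0 ≤ g x
    · simp [sg, hx, abs_of_nonneg hx]
    · simp [sg, hx, abs_of_neg (not_le.1 hx)]
  have key : ∀ n, ∫ x, ‖a n x‖ ^ p.toReal ∂μ ≤ K ^ p.toReal := by
    intro n
    -- The extremal function in Hölder's inequality: since `(p - 1) q = p`, `∫ |φ|^q` is again `S`,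
    -- while `∫ φ g ≥ S` because `a n ≤ |g|`.
    let φ : SimpleFunc α ℝ := sg * (a n).map (fun t => t ^ (p.toReal - 1))
    have hφ : ∀ x, φ x = sg x * a n x ^ (p.toReal - 1) := fun x => by simp [φ]
    set S := ∫ x, ‖a n x‖ ^ p.toReal ∂μ with hS
    have hS0 : 0 ≤ S := integral_nonneg fun x => by positivity
    have i1 : Integrable (fun x => ‖a n x‖ ^ p.toReal) μ :=
      ((a n).memLp_of_isFiniteMeasure p μ).integrable_norm_rpow hp0 hp'.ne
    obtain ⟨C, hC⟩ := φ.exists_forall_norm_le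
    have i2 : Integrable (fun x => φ x * g x) μ :=
      hgi.bdd_mul φ.aestronglyMeasurable (ae_of_all _ hC)
    have h1 : S ≤ ∫ x, φ x * g x ∂μ := by
      refine integral_mono i1 i2 fun x => ?_
      have e1 : φ x * g x = a n x ^ (p.toReal - 1) * |g x| := by
        rw [hφ, ← (hsg x).1]; ring
      have e2 : ‖a n x‖ ^ p.toReal = a n x ^ (p.toReal - 1) * a n x := by
        rw [Real.norm_of_nonneg (ha0 n x)]
        rcases (ha0 n x).eq_or_lt with h0 | h0
        · rw [← h0, Real.zero_rpow (by linarith), mul_zero]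
        · rw [Real.rpow_sub_one h0.ne', div_mul_cancel₀ _ h0.ne']
      change ‖a n x‖ ^ p.toReal ≤ φ x * g x
      rw [e1, e2]
      exact mul_le_mul_of_nonneg_left (hag n x) (Real.rpow_nonneg (ha0 n x) _)
    have h2 : ∫ x, ‖φ x‖ ^ q.toReal ∂μ = S := by
      refine integral_congr_ae (ae_of_all _ fun x => ?_)
      change ‖φ x‖ ^ q.toReal = ‖a n x‖ ^ p.toReal
      rw [hφ, norm_mul, Real.norm_eq_abs (sg x), (hsg x).2, one_mul,
        Real.norm_of_nonneg (Real.rpow_nonneg (ha0 n x) _), Real.norm_of_nonneg (ha0 n x),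
        ← Real.rpow_mul (ha0 n x), hPQ.sub_one_mul_conj]
    have h3 := h φ
    rw [h2] at h3
    have h4 : S ≤ K * S ^ q.toReal⁻¹ := h1.trans h3
    rcases hS0.eq_or_lt with h0 | h0
    · rw [← h0]; positivity
    -- Cancel `S^(1/q)` in `S ≤ K S^(1/q)`, using `1/p + 1/q = 1`.
    · have h5 : S ^ p.toReal⁻¹ ≤ K := by
        have e1 : S = S ^ p.toReal⁻¹ * S ^ q.toReal⁻¹ := by
          rw [← Real.rpow_add h0, hPQ.inv_add_inv_eq_one, Real.rpow_one]
        exact le_of_mul_le_mul_right (e1.symm.trans_le h4) (by positivity)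
      have h6 := Real.rpow_le_rpow (by positivity) h5 (by linarith : (0:ℝ) ≤ p.toReal)
      rwa [← Real.rpow_mul hS0, inv_mul_cancel₀ (by linarith), Real.rpow_one] at h6
  have hm := (memLp_of_tendsto_ae_of_integral_rpow_le (g := fun x => ‖g x‖) hp0 hp'.ne
    (fun n => (a n).memLp_of_isFiniteMeasure p μ) key (ae_of_all _ hat)).1
  exact (memLp_norm_iff hg.aestronglyMeasurable).1 hm

/-- Riesz representation of continuous functionals on `L^q`, for a finite measure. -/
theorem exists_memLp_of_dual {p q : ℝ≥0∞} [Fact (1 ≤ q)] (hp : 1 < p) (hp' : p < ⊤)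
    (hpq : p.HolderConjugate q) (hq : q ≠ ⊤) (l : StrongDual ℝ (Lp ℝ q μ)) :
    ∃ g : α → ℝ, MemLp g p μ ∧ ∀ f : Lp ℝ q μ, l f = ∫ x, f x * g x ∂μ := by
  obtain ⟨g, hgm, hgi, hg⟩ := exists_density_of_dual hq l
  have hq0 : q ≠ 0 := (zero_lt_one.trans_le Fact.out).ne'
  have hmem : MemLp g p μ := by
    refine memLp_of_integral_simpleFunc_mul_le hp hp' hpq hgm hgi (norm_nonneg l) fun s => ?_
    rw [← hg s]
    refine (le_abs_self _).trans ((l.le_opNorm _).trans_eq ?_)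
    rw [Lp.norm_toLp, (s.memLp_of_isFiniteMeasure q μ).eLpNorm_eq_integral_rpow_norm hq0 hq,
      ENNReal.toReal_ofReal]
    exact Real.rpow_nonneg (integral_nonneg fun x => by positivity) _
  refine ⟨g, hmem, fun f => ?_⟩
  have : Fact (1 ≤ p) := ⟨hp.le⟩
  have := hpq.symm
  have hint : ∀ f : Lp ℝ q μ, ∫ x, f x * g x ∂μ
      = (ContinuousLinearMap.mul ℝ ℝ).lpPairing μ q p f (hmem.toLp g) := by
    intro f
    rw [ContinuousLinearMap.lpPairing_eq_integral]
    refine integral_congr_ae ?_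
    filter_upwards [hmem.coeFn_toLp] with x hx
    simp [hx]
  rw [hint]
  -- Both sides are continuous in `f` once the integral is written as a duality pairing, so
  -- agreement on simple functions is enough.
  induction f using Lp.induction hq with
  | indicatorConst c hs hμs =>
    rename_i A
    have e : (Lp.simpleFunc.indicatorConst q hs hμs.ne c : Lp ℝ q μ)
        = ((SimpleFunc.piecewise A hs (SimpleFunc.const _ c)
          (SimpleFunc.const _ 0)).memLp_of_isFiniteMeasure q μ).toLp _ := by
      rfl
    rw [e, hg, ← hint]
    refine integral_congr_ae ?_
    filter_upwards [((SimpleFunc.piecewise A hs (SimpleFunc.const _ c)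
          (SimpleFunc.const _ 0)).memLp_of_isFiniteMeasure q μ).coeFn_toLp] with x hx
    rw [hx]
  | add hf hg' _ h1 h2 => rw [map_add, h1, h2, map_add, add_apply]
  | isClosed => exact isClosed_eq l.continuous (by fun_prop)

end Riesz

/-! ### Riesz representation for vector-valued functions, by coordinates. -/

section VectorRiesz

variable {α : Type*} [MeasurableSpace α] {μ : Measure α} [IsFiniteMeasure μ]

/-- Riesz representation of continuous functionals on `L^q(μ; F)`, for a finite measure and a
finite-dimensional Euclidean space `F`. -/
theorem exists_memLp_inner_of_dual {F : Type*} [NormedAddCommGroup F] [InnerProductSpace ℝ F]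
    [FiniteDimensional ℝ F] {p q : ℝ≥0∞} [Fact (1 ≤ q)] (hp : 1 < p) (hp' : p < ⊤)
    (hpq : p.HolderConjugate q) (hq : q ≠ ⊤) (l : StrongDual ℝ (Lp F q μ)) :
    ∃ V : α → F, MemLp V p μ ∧ ∀ f : Lp F q μ, l f = ∫ x, ⟪f x, V x⟫ ∂μ := by
  let b := stdOrthonormalBasis ℝ F
  let inj := fun i => ContinuousLinearMap.compLpL (p := q) (μ := μ)
    (ContinuousLinearMap.toSpanSingleton ℝ (b i))
  let proj := fun i => ContinuousLinearMap.compLpL (p := q) (μ := μ) (innerSL ℝ (b i))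
  choose g hg hgl using fun i => exists_memLp_of_dual hp hp' hpq hq (l.comp (inj i))
  have hproj : ∀ i (f : Lp F q μ), proj i f =ᵐ[μ] fun x => ⟪b i, f x⟫ := fun i f =>
    ContinuousLinearMap.coeFn_compLp _ f
  have hinj : ∀ i (f : Lp ℝ q μ), inj i f =ᵐ[μ] fun x => f x • b i := fun i f =>
    ContinuousLinearMap.coeFn_compLp _ f
  refine ⟨fun x => ∑ i, g i x • b i, memLp_finsetSum _ fun i _ => ?_, fun f => ?_⟩
  · exact MemLp.smul (p := p) (q := ⊤) (r := p) (memLp_const (b i)) (hg i)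
  · have hf : f = ∑ i, inj i (proj i f) := by
      refine Lp.ext ?_
      have h1 := Lp.coeFn_finsetSum Finset.univ fun i => inj i (proj i f)
      have h2 : ∀ᵐ x ∂μ, ∀ i, inj i (proj i f) x = ⟪b i, f x⟫ • b i := by
        refine ae_all_iff.2 fun i => ?_
        filter_upwards [hinj i (proj i f), hproj i f] with x e1 e2
        rw [e1, e2]
      filter_upwards [h1, h2] with x e1 e2
      rw [e1, Finset.sum_apply, Finset.sum_congr rfl fun i _ => e2 i, b.sum_repr']
    have hfg : ∀ i, Integrable (fun x => ⟪b i, f x⟫ * g i x) μ := fun i => by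
      have := hpq.symm
      exact MemLp.integrable_mul (p := q) (q := p) ((Lp.memLp f).const_inner (b i)) (hg i)
    have hl : l f = ∑ i, ∫ x, ⟪b i, f x⟫ * g i x ∂μ := by
      conv_lhs => rw [hf]
      rw [map_sum]
      refine Finset.sum_congr rfl fun i _ => (hgl i (proj i f)).trans (integral_congr_ae ?_)
      filter_upwards [hproj i f] with x e1
      rw [e1]
    rw [hl, ← integral_finsetSum _ fun i _ => hfg i]
    refine integral_congr_ae (ae_of_all _ fun x => ?_)
    simp only [inner_sum, inner_smul_right]
    exact Finset.sum_congr rfl fun i _ => by rw [real_inner_comm, mul_comm]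

end VectorRiesz

/-! ### Existence and convexity of admissible fields. -/

section Admissible

variable {N : ℕ} {Ω : Compacts (Euc N)} {p q : ℝ≥0∞} [Fact (1 ≤ q)]

/-- Because the norm on the quotient space is `‖∇u‖`, `T` vanishes on the kernel of the gradient and
descends to a bounded functional on its range, which Hahn–Banach extends. -/
theorem exists_grad_extension (T : DualSobolev Ω q) :
    ∃ l : StrongDual ℝ (Lp (Euc N) q (leb Ω)), ∀ u, l (HomSobolev.grad Ω q u) = T u := by
  set G := HomSobolev.grad Ω q with hG
  have hbound : ∀ u, |T u| ≤ ‖T‖ * ‖G u‖ := fun u => T.le_opNorm u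
  have hker : LinearMap.ker G ≤ LinearMap.ker (T : HomSobolev Ω q →ₗ[ℝ] ℝ) := by
    intro u hu
    have h := hbound u
    rw [LinearMap.mem_ker.1 hu, norm_zero, mul_zero] at h
    exact LinearMap.mem_ker.2 (abs_nonpos_iff.1 h)
  let f : LinearMap.range G →ₗ[ℝ] ℝ :=
    ((LinearMap.ker G).liftQ (T : HomSobolev Ω q →ₗ[ℝ] ℝ) hker).comp
      (G.quotKerEquivRange.symm : LinearMap.range G →ₗ[ℝ] _)
  have hf : ∀ u, f ⟨G u, u, rfl⟩ = T u := by
    intro u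
    have : G.quotKerEquivRange.symm ⟨G u, u, rfl⟩ = (LinearMap.ker G).mkQ u :=
      G.quotKerEquivRange_symm_apply_image u _
    simp only [f, LinearMap.comp_apply, LinearEquiv.coe_coe, this]
    exact (LinearMap.ker G).liftQ_apply _ u
  let f' : StrongDual ℝ (LinearMap.range G) := f.mkContinuous ‖T‖ (by
    rintro ⟨_, u, rfl⟩
    rw [hf]
    exact hbound u)
  obtain ⟨l, hl, _⟩ := exists_extension_norm_eq (LinearMap.range G) f'
  exact ⟨l, fun u => (hl ⟨G u, u, rfl⟩).trans (hf u)⟩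

theorem isAdmissible_congr {T : DualSobolev Ω q} {V W : Euc N → Euc N}
    (h : V =ᵐ[leb Ω] W) (hV : IsAdmissible Ω q T V) : IsAdmissible Ω q T W := by
  intro φ hφ
  rw [← hV φ hφ]
  refine integral_congr_ae ?_
  filter_upwards [h] with x hx
  rw [hx]

theorem exists_isAdmissible (hp : 1 < p) (hp' : p < ⊤) (hpq : p.HolderConjugate q)
    (T : DualSobolev Ω q) : ∃ V : Lp (Euc N) p (leb Ω), IsAdmissible Ω q T V := by
  have hq : q ≠ ⊤ := by
    rintro rfl
    have h := ENNReal.holderConjugate_iff.1 hpq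
    rw [ENNReal.inv_top, add_zero, ENNReal.inv_eq_one] at h
    exact hp.ne' h
  obtain ⟨l, hl⟩ := exists_grad_extension T
  obtain ⟨V, hV, hlV⟩ := exists_memLp_inner_of_dual hp hp' hpq hq l
  refine ⟨hV.toLp V, isAdmissible_congr hV.coeFn_toLp.symm fun φ hφ => ?_⟩
  rw [← hl, hlV]
  refine integral_congr_ae ?_
  filter_upwards [(memLp_of_continuous Ω q (continuous_gradient hφ)).coeFn_toLp] with x hx
  have : (HomSobolev.grad Ω q (HomSobolev.ofC1 Ω q φ hφ)) x = ∇ φ x := hx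
  rw [this]

theorem integrable_inner_gradient {φ : Euc N → ℝ} (hφ : ContDiff ℝ 1 φ) {V : Euc N → Euc N}
    (hV : Integrable V (leb Ω)) : Integrable (fun x => ⟪∇ φ x, V x⟫) (leb Ω) := by
  obtain ⟨C, hC⟩ := Ω.isCompact.exists_bound_of_continuousOn (continuous_gradient hφ).continuousOn
  have hC' : ∀ᵐ x ∂(leb Ω), ‖∇ φ x‖ ≤ C :=
    (ae_restrict_iff' Ω.isCompact.measurableSet).2 (Filter.Eventually.of_forall hC)
  refine (hV.norm.const_mul C).mono'
    ((continuous_gradient hφ).aestronglyMeasurable.inner hV.1) ?_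
  filter_upwards [hC'] with x hx
  exact (norm_inner_le_norm _ _).trans (mul_le_mul_of_nonneg_right hx (norm_nonneg _))

theorem IsAdmissible.midpoint {T : DualSobolev Ω q} {V W : Euc N → Euc N}
    (hVi : Integrable V (leb Ω)) (hWi : Integrable W (leb Ω))
    (hV : IsAdmissible Ω q T V) (hW : IsAdmissible Ω q T W) :
    IsAdmissible Ω q T fun x => (2⁻¹ : ℝ) • (V x + W x) := by
  intro φ hφ
  simp only [inner_smul_right, inner_add_right]
  rw [integral_const_mul, integral_add (integrable_inner_gradient hφ hVi)
    (integrable_inner_gradient hφ hWi), hV φ hφ, hW φ hφ]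
  ring

end Admissible

/-! ### Almost everywhere convergent selections from nested convex sets. -/

section Compactness

open Filter

/-- The strictly convex function `z ↦ √(1 + |z|²)`, of linear growth. -/
noncomputable def japaneseBracket {F : Type*} [NormedAddCommGroup F] (z : F) : ℝ := √(1 + ‖z‖ ^ 2)

section Pointwise

variable {F : Type*} [NormedAddCommGroup F]

theorem japaneseBracket_sq (z : F) : japaneseBracket z ^ 2 = 1 + ‖z‖ ^ 2 :=
  Real.sq_sqrt (by positivity)

theorem japaneseBracket_pos (z : F) : 0 < japaneseBracket z :=
  Real.sqrt_pos.2 (by positivity)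

theorem norm_le_japaneseBracket (z : F) : ‖z‖ ≤ japaneseBracket z :=
  Real.le_sqrt_of_sq_le (by linarith)

theorem japaneseBracket_le (z : F) : japaneseBracket z ≤ 1 + ‖z‖ :=
  Real.sqrt_le_iff.2 ⟨by positivity, by nlinarith [norm_nonneg z]⟩

theorem continuous_japaneseBracket : Continuous (japaneseBracket : F → ℝ) := by
  unfold japaneseBracket
  fun_prop

variable [InnerProductSpace ℝ F]

/-- The midpoint convexity gap of `japaneseBracket`. -/
noncomputable def bracketGap (a b : F) : ℝ :=
  (japaneseBracket a + japaneseBracket b) / 2 - japaneseBracket ((2⁻¹ : ℝ) • (a + b))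

/-- Quantitative strict convexity, degenerating polynomially at infinity. With `A`, `B`, `D` the
brackets of `a`, `b` and their midpoint, the parallelogram law gives `((A + B)/2)² - D² = |a - b|²/4
- (A - B)²/4`, and the summand `1` under the root keeps `(A - B)²` strictly below `|a - b|²`. -/
theorem norm_sub_sq_le_bracketGap (a b : F) :
    ‖a - b‖ ^ 2 ≤ 2 * bracketGap a b * (japaneseBracket a + japaneseBracket b) ^ 3 := by
  unfold bracketGap
  set A := japaneseBracket a with hA
  set B := japaneseBracket b with hB
  set D := japaneseBracket ((2⁻¹ : ℝ) • (a + b)) with hD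
  have hA0 : 0 < A := japaneseBracket_pos a
  have hB0 : 0 < B := japaneseBracket_pos b
  have hD0 : 0 < D := japaneseBracket_pos _
  have hA2 : A ^ 2 = 1 + ‖a‖ ^ 2 := japaneseBracket_sq a
  have hB2 : B ^ 2 = 1 + ‖b‖ ^ 2 := japaneseBracket_sq b
  have hAa : ‖a‖ ≤ A := norm_le_japaneseBracket a
  have hBb : ‖b‖ ≤ B := norm_le_japaneseBracket b
  have hpar := parallelogram_law_with_norm ℝ a b
  have hD2 : D ^ 2 = (A ^ 2 + B ^ 2) / 2 - ‖a - b‖ ^ 2 / 4 := by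
    rw [hD, japaneseBracket_sq, norm_smul, hA2, hB2]
    norm_num
    nlinarith
  have hdiff : (‖a‖ - ‖b‖) ^ 2 ≤ ‖a - b‖ ^ 2 :=
    sq_le_sq.2 (by rw [abs_norm]; exact abs_norm_sub_norm_le a b)
  set t := ‖a - b‖ ^ 2 with ht
  have ht0 : 0 ≤ t := by positivity
  have hAB : (A - B) ^ 2 * (A + B) ^ 2 ≤ t * ((A + B) ^ 2 - 2) := by
    have e : (A - B) ^ 2 * (A + B) ^ 2 = (‖a‖ - ‖b‖) ^ 2 * (‖a‖ + ‖b‖) ^ 2 := by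
      have : (A - B) * (A + B) = (‖a‖ - ‖b‖) * (‖a‖ + ‖b‖) := by linarith
      rw [← mul_pow, ← mul_pow, this]
    have hprod : ‖a‖ * ‖b‖ ≤ A * B := mul_le_mul hAa hBb (norm_nonneg b) hA0.le
    -- The `2` collects the two summands `1` in `A²` and `B²`.
    have h2 : (‖a‖ + ‖b‖) ^ 2 ≤ (A + B) ^ 2 - 2 := by nlinarith
    rw [e]
    exact mul_le_mul hdiff h2 (by positivity) ht0
  have hfac : ((A + B) / 2 - D) * ((A + B) / 2 + D) * (A + B) ^ 2 ≥ t / 2 := by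
    have : ((A + B) / 2 - D) * ((A + B) / 2 + D) = t / 4 - (A - B) ^ 2 / 4 := by nlinarith
    rw [this]
    nlinarith
  have hDle : D ≤ (A + B) / 2 := by
    by_contra hlt
    push Not at hlt
    have h3 : ((A + B) / 2 - D) * (((A + B) / 2 + D) * (A + B) ^ 2) < 0 :=
      mul_neg_of_neg_of_pos (by linarith) (by positivity)
    nlinarith
  -- The factor `(A + B)/2 + D` is at most `A + B`, which yields the third power.
  have h4 : ((A + B) / 2 - D) * (A + B) ^ 2 * ((A + B) / 2 + D)
      ≤ ((A + B) / 2 - D) * (A + B) ^ 2 * (A + B) :=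
    mul_le_mul_of_nonneg_left (by linarith) (mul_nonneg (by linarith) (by positivity))
  nlinarith

theorem bracketGap_nonneg (a b : F) : 0 ≤ bracketGap a b := by
  have h := norm_sub_sq_le_bracketGap a b
  have hpos : 0 < (japaneseBracket a + japaneseBracket b) ^ 3 := by
    have := japaneseBracket_pos a
    have := japaneseBracket_pos b
    positivity
  by_contra hlt
  push Not at hlt
  nlinarith [mul_neg_of_neg_of_pos hlt hpos, sq_nonneg ‖a - b‖]

/-- The previous bound involves the cube of the brackets, whose integral is not controlled. Its
fourth root is a weighted geometric mean of one gap and three brackets, so a Young-type inequality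
makes it linear in both, with `δ` free to balance them. -/
theorem sqrt_norm_sub_le (a b : F) {δ : ℝ} (hδ : 0 < δ) :
    √‖a - b‖ ≤ 2 * (bracketGap a b / δ ^ 3 + δ * (japaneseBracket a + japaneseBracket b)) := by
  have h := norm_sub_sq_le_bracketGap a b
  have hg := bracketGap_nonneg a b
  set g := bracketGap a b
  set M := japaneseBracket a + japaneseBracket b
  have hM : 0 < M := add_pos (japaneseBracket_pos a) (japaneseBracket_pos b)
  set s := √‖a - b‖
  have hs : s ^ 4 = ‖a - b‖ ^ 2 := by
    rw [show s ^ 4 = (s ^ 2) ^ 2 by ring, Real.sq_sqrt (norm_nonneg _)]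
  set y := g / δ ^ 3 with hy
  have hgy : g = y * δ ^ 3 := by rw [hy]; field_simp
  have hy0 : 0 ≤ y := by positivity
  have hx0 : 0 < δ * M := by positivity
  refine le_of_pow_le_pow_left₀ (n := 4) (by norm_num) (by positivity) ?_
  rw [hs]
  refine h.trans ?_
  rw [hgy, show 2 * (y * δ ^ 3) * M ^ 3 = 2 * y * (δ * M) ^ 3 by ring]
  set x := δ * M
  have h1 : 0 ≤ y * x ^ 3 := by positivity
  have h2 : 0 ≤ y ^ 2 * x ^ 2 := by positivity
  have h3 : 0 ≤ y ^ 3 * x := by positivity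
  have h4 : 0 ≤ y ^ 4 := by positivity
  have h5 : 0 ≤ x ^ 4 := by positivity
  nlinarith

end Pointwise

variable {α : Type*} [MeasurableSpace α] {μ : Measure α}
  {F : Type*} [NormedAddCommGroup F]

/-- By monotone convergence the square roots of the increments are summable a.e.; once below `1`
they dominate the increments themselves, so the sequence is Cauchy. -/
theorem ae_exists_tendsto_of_summable_integral_sqrt [CompleteSpace F] {v : ℕ → α → F}
    (hi : ∀ n, Integrable (fun x => √‖v n x - v (n + 1) x‖) μ)
    (hs : Summable fun n => ∫ x, √‖v n x - v (n + 1) x‖ ∂μ) :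
    ∃ V : α → F, ∀ᵐ x ∂μ, Tendsto (fun n => v n x) atTop (𝓝 (V x)) := by
  have hfin : ∫⁻ x, ∑' n, ENNReal.ofReal (√‖v n x - v (n + 1) x‖) ∂μ ≠ ⊤ := by
    rw [lintegral_tsum fun n => (hi n).1.aemeasurable.ennreal_ofReal]
    have e : ∀ n, ∫⁻ x, ENNReal.ofReal (√‖v n x - v (n + 1) x‖) ∂μ
        = ENNReal.ofReal (∫ x, √‖v n x - v (n + 1) x‖ ∂μ) := fun n =>
      (ofReal_integral_eq_lintegral_ofReal (hi n) (ae_of_all _ fun x => Real.sqrt_nonneg _)).symm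
    simp only [e]
    exact hs.tsum_ofReal_ne_top
  have hae := ae_lt_top' (AEMeasurable.tsum fun n =>
    (hi n).1.aemeasurable.ennreal_ofReal) hfin
  have hex : ∀ᵐ x ∂μ, ∃ y, Tendsto (fun n => v n x) atTop (𝓝 y) := by
    filter_upwards [hae] with x hx
    have h1 : Summable fun n => √‖v n x - v (n + 1) x‖ := by
      simpa [ENNReal.toReal_ofReal (Real.sqrt_nonneg _)] using ENNReal.summable_toReal hx.ne
    have h2 : Summable fun n => dist (v n x) (v (n + 1) x) := by
      refine Summable.of_norm_bounded_eventually_nat h1 ?_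
      filter_upwards [h1.tendsto_atTop_zero.eventually_le_const one_pos] with n hn
      rw [Real.norm_of_nonneg dist_nonneg, dist_eq_norm]
      calc ‖v n x - v (n + 1) x‖ = √‖v n x - v (n + 1) x‖ * √‖v n x - v (n + 1) x‖ :=
            (Real.mul_self_sqrt (norm_nonneg _)).symm
        _ ≤ √‖v n x - v (n + 1) x‖ := mul_le_of_le_one_right (Real.sqrt_nonneg _) hn
    exact cauchySeq_tendsto_of_complete (cauchySeq_of_summable_dist h2)
  classical
  refine ⟨fun x => if h : ∃ y, Tendsto (fun n => v n x) atTop (𝓝 y) then h.choose else 0, ?_⟩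
  filter_upwards [hex] with x hx
  rw [dif_pos hx]
  exact hx.choose_spec

variable [IsFiniteMeasure μ]

theorem integrable_japaneseBracket {v : α → F} (hv : Integrable v μ) :
    Integrable (fun x => japaneseBracket (v x)) μ := by
  refine ((integrable_const (1 : ℝ)).add hv.norm).mono'
    (continuous_japaneseBracket.comp_aestronglyMeasurable hv.1) (ae_of_all _ fun x => ?_)
  rw [Real.norm_of_nonneg (japaneseBracket_pos _).le]
  exact japaneseBracket_le _

/-- The infima `d n` of `G = ∫ √(1 + |v|²)` over `C n` increase to a finite limit `D`. If `v n` and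
`v (n + 1)` nearly realise infima close to `D`, their midpoint lies in the larger of the two sets,
so its `G` cannot be much smaller and the midpoint gap must be small. -/
theorem exists_mem_integral_bracketGap_le [InnerProductSpace ℝ F]
    {C : ℕ → Set (α → F)} (hanti : Antitone C)
    (hne : ∀ n, (C n).Nonempty) (hmid : ∀ n, ∀ v ∈ C n, ∀ w ∈ C n,
      (fun x => (2⁻¹ : ℝ) • (v x + w x)) ∈ C n)
    (hint : ∀ v ∈ C 0, Integrable v μ) {B : ℝ} (hB : ∀ v ∈ C 0, ∫ x, ‖v x‖ ∂μ ≤ B)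
    {ε : ℕ → ℝ} (hε : ∀ n, 0 < ε n) (hεa : Antitone ε) :
    ∃ v : ℕ → α → F, (∀ n, v n ∈ C n) ∧
      ∀ n, ∫ x, bracketGap (v n x) (v (n + 1) x) ∂μ ≤ 2 * ε n := by
  have hC0 : ∀ n, C n ⊆ C 0 := fun n => hanti (Nat.zero_le n)
  let G : (α → F) → ℝ := fun v => ∫ x, japaneseBracket (v x) ∂μ
  have hG0 : ∀ v, 0 ≤ G v := fun v => integral_nonneg fun x => (japaneseBracket_pos _).le
  have hGB : ∀ v ∈ C 0, G v ≤ μ.real univ + B := by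
    intro v hv
    have h1 : G v ≤ ∫ x, (1 + ‖v x‖) ∂μ :=
      integral_mono (integrable_japaneseBracket (hint v hv))
        ((integrable_const _).add (hint v hv).norm) fun x => japaneseBracket_le _
    rw [integral_add (integrable_const _) (hint v hv).norm] at h1
    have := hB v hv
    simp only [integral_const, smul_eq_mul, mul_one] at h1
    linarith
  let d : ℕ → ℝ := fun n => sInf (G '' C n)
  have hbdd : ∀ n, BddBelow (G '' C n) := fun n => ⟨0, by rintro _ ⟨v, _, rfl⟩; exact hG0 v⟩
  have hdle : ∀ n, ∀ v ∈ C n, d n ≤ G v := fun n v hv => csInf_le (hbdd n) ⟨v, hv, rfl⟩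
  have hdmono : Monotone d := fun m n hmn =>
    csInf_le_csInf (hbdd m) ((hne n).image G) (image_mono (hanti hmn))
  have hdbdd : BddAbove (range d) := by
    refine ⟨μ.real univ + B, ?_⟩
    rintro _ ⟨n, rfl⟩
    obtain ⟨v, hv⟩ := hne n
    exact (hdle n v hv).trans (hGB v (hC0 n hv))
  set D := ⨆ n, d n with hD
  have hdD : ∀ n, d n ≤ D := fun n => le_ciSup hdbdd n
  have hlim : Tendsto d atTop (𝓝 D) := tendsto_atTop_ciSup hdmono hdbdd
  -- Pass to indices at which the infimum is already within `ε n` of its limit.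
  obtain ⟨φ, hφ, hφd⟩ := extraction_forall_of_eventually'
    (P := fun n k => D - ε n < d k) fun n => by
      have := hlim.eventually (lt_mem_nhds (sub_lt_self D (hε n)))
      exact eventually_atTop.1 this
  have hsel : ∀ n, ∃ v ∈ C (φ n), G v < d (φ n) + ε n := by
    intro n
    obtain ⟨_, ⟨v, hv, rfl⟩, hlt⟩ := exists_lt_of_csInf_lt ((hne (φ n)).image G)
      (lt_add_of_pos_right (d (φ n)) (hε n))
    exact ⟨v, hv, hlt⟩
  choose v hvC hvG using hsel
  refine ⟨v, fun n => hanti hφ.le_apply (hvC n), fun n => ?_⟩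
  have hv1 : v (n + 1) ∈ C (φ n) := hanti (hφ.monotone n.le_succ) (hvC (n + 1))
  have hm := hmid _ _ (hvC n) _ hv1
  have hI : ∀ w ∈ C (φ n), Integrable (fun x => japaneseBracket (w x)) μ :=
    fun w hw => integrable_japaneseBracket (hint w (hC0 _ hw))
  have e : ∫ x, bracketGap (v n x) (v (n + 1) x) ∂μ
      = (G (v n) + G (v (n + 1))) / 2 - G (fun x => (2⁻¹ : ℝ) • (v n x + v (n + 1) x)) := by
    unfold bracketGap
    have hs : Integrable (fun x => japaneseBracket (v n x) + japaneseBracket (v (n + 1) x)) μ :=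
      (hI _ (hvC n)).add (hI _ hv1)
    rw [integral_sub (hs.div_const 2) (hI _ hm), integral_div,
      integral_add (hI _ (hvC n)) (hI _ hv1)]
  rw [e]
  have h1 := hdle _ _ hm
  have h2 := hvG n
  have h3 := hvG (n + 1)
  have h4 := hφd n
  have h5 := hdD (φ n)
  have h6 := hdD (φ (n + 1))
  have h7 := hεa n.le_succ
  linarith

/-- From a decreasing sequence of nonempty convex sets of functions, bounded in `L¹`, one can
select an almost everywhere convergent sequence. -/
theorem exists_mem_ae_tendsto [InnerProductSpace ℝ F] [CompleteSpace F]
    {C : ℕ → Set (α → F)} (hanti : Antitone C)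
    (hne : ∀ n, (C n).Nonempty) (hmid : ∀ n, ∀ v ∈ C n, ∀ w ∈ C n,
      (fun x => (2⁻¹ : ℝ) • (v x + w x)) ∈ C n)
    (hint : ∀ v ∈ C 0, Integrable v μ) {B : ℝ} (hB : ∀ v ∈ C 0, ∫ x, ‖v x‖ ∂μ ≤ B) :
    ∃ v : ℕ → α → F, (∀ n, v n ∈ C n) ∧
      ∃ V : α → F, ∀ᵐ x ∂μ, Tendsto (fun n => v n x) atTop (𝓝 (V x)) := by
  -- With `ε = 16⁻ⁿ` and `δ = 2⁻ⁿ` in `sqrt_norm_sub_le`, the quotient `ε / δ³` equals `2⁻ⁿ`, so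
  -- both terms are summable.
  obtain ⟨v, hvC, hgap⟩ := exists_mem_integral_bracketGap_le (μ := μ) hanti hne hmid hint hB
    (ε := fun n => (16⁻¹ : ℝ) ^ n) (fun n => by positivity)
    (pow_right_anti₀ (by norm_num) (by norm_num))
  have hvi : ∀ n, Integrable (v n) μ := fun n => hint _ (hanti (Nat.zero_le n) (hvC n))
  have hJ : ∀ n, Integrable (fun x => japaneseBracket (v n x)) μ := fun n =>
    integrable_japaneseBracket (hvi n)
  have hJB : ∀ n, ∫ x, japaneseBracket (v n x) ∂μ ≤ μ.real univ + B := by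
    intro n
    have h1 : ∫ x, japaneseBracket (v n x) ∂μ ≤ ∫ x, (1 + ‖v n x‖) ∂μ :=
      integral_mono (hJ n) ((integrable_const _).add (hvi n).norm) fun x => japaneseBracket_le _
    rw [integral_add (integrable_const _) (hvi n).norm] at h1
    have := hB _ (hanti (Nat.zero_le n) (hvC n))
    simp only [integral_const, smul_eq_mul, mul_one] at h1
    linarith
  have hJJ : ∀ n, Integrable (fun x => japaneseBracket (v n x) + japaneseBracket (v (n + 1) x)) μ :=
    fun n => (hJ n).add (hJ (n + 1))
  have hgi : ∀ n, Integrable (fun x => bracketGap (v n x) (v (n + 1) x)) μ := fun n =>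
    ((hJJ n).div_const 2).sub
      (integrable_japaneseBracket (((hvi n).add (hvi (n + 1))).smul (2⁻¹ : ℝ)))
  have hpt : ∀ n x, √‖v n x - v (n + 1) x‖ ≤ 2 * (bracketGap (v n x) (v (n + 1) x)
      / ((2⁻¹ : ℝ) ^ n) ^ 3 + (2⁻¹ : ℝ) ^ n * (japaneseBracket (v n x)
      + japaneseBracket (v (n + 1) x))) := fun n x => sqrt_norm_sub_le _ _ (by positivity)
  have hdom : ∀ n, Integrable (fun x => 2 * (bracketGap (v n x) (v (n + 1) x)
      / ((2⁻¹ : ℝ) ^ n) ^ 3 + (2⁻¹ : ℝ) ^ n * (japaneseBracket (v n x)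
      + japaneseBracket (v (n + 1) x)))) μ := fun n =>
    (((hgi n).div_const _).add ((hJJ n).const_mul _)).const_mul 2
  have hi : ∀ n, Integrable (fun x => √‖v n x - v (n + 1) x‖) μ := fun n => by
    refine (hdom n).mono' (Real.continuous_sqrt.comp_aestronglyMeasurable
      ((hvi n).sub (hvi (n + 1))).1.norm) (ae_of_all _ fun x => ?_)
    rw [Real.norm_of_nonneg (Real.sqrt_nonneg _)]
    exact hpt n x
  refine ⟨v, hvC, ae_exists_tendsto_of_summable_integral_sqrt hi ?_⟩
  refine Summable.of_nonneg_of_le (f := fun n => (2⁻¹ : ℝ) ^ n * (4 + 4 * (μ.real univ + B)))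
    (fun n => integral_nonneg fun x => Real.sqrt_nonneg _) (fun n => ?_)
    ((summable_geometric_of_lt_one (by norm_num) (by norm_num)).mul_right _)
  refine (integral_mono (hi n) (hdom n) (hpt n)).trans ?_
  rw [integral_const_mul, integral_add ((hgi n).div_const _)
    ((hJJ n).const_mul _), integral_div, integral_const_mul,
    integral_add (hJ n) (hJ (n + 1))]
  have h1 : (∫ x, bracketGap (v n x) (v (n + 1) x) ∂μ) / ((2⁻¹ : ℝ) ^ n) ^ 3
      ≤ 2 * (2⁻¹ : ℝ) ^ n := by
    rw [div_le_iff₀ (by positivity)]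
    refine (hgap n).trans_eq ?_
    rw [mul_assoc, ← pow_succ', ← pow_mul, mul_comm n, pow_mul]
    norm_num
  have h2 : (2⁻¹ : ℝ) ^ n * (∫ x, japaneseBracket (v n x) ∂μ
      + ∫ x, japaneseBracket (v (n + 1) x) ∂μ) ≤ (2⁻¹ : ℝ) ^ n * (2 * (μ.real univ + B)) :=
    mul_le_mul_of_nonneg_left (by linarith [hJB n, hJB (n + 1)]) (by positivity)
  linarith

end Compactness

/-! ### Lower semicontinuity, strict convexity and minimization of the energy. -/

section Energy

open Filter

/-- Fatou's lemma, applied after adding `K`, which has finite integral on a finite measure space. -/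
theorem integral_le_of_tendsto_ae {α : Type*} [MeasurableSpace α] {μ : Measure α}
    [IsFiniteMeasure μ] {f : ℕ → α → ℝ} {g : α → ℝ} {K c : ℝ} {b : ℕ → ℝ}
    (hf : ∀ n, Integrable (f n) μ) (hg : Integrable g μ) (hK : ∀ n, ∀ᵐ x ∂μ, -K ≤ f n x)
    (hfg : ∀ᵐ x ∂μ, Tendsto (fun n => f n x) atTop (𝓝 (g x)))
    (hb : ∀ n, ∫ x, f n x ∂μ ≤ b n) (hbc : Tendsto b atTop (𝓝 c)) :
    ∫ x, g x ∂μ ≤ c := by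
  set M := K * μ.real univ with hM
  have hadd : ∀ h : α → ℝ, Integrable h μ → ∫ x, (h x + K) ∂μ = ∫ x, h x ∂μ + M := fun h hh => by
    rw [integral_add hh (integrable_const K), integral_const, smul_eq_mul, mul_comm, hM]
  have hf0 : ∀ n, 0 ≤ᵐ[μ] fun x => f n x + K := fun n => by
    filter_upwards [hK n] with x hx
    simp only [Pi.zero_apply]
    linarith
  have hg0 : 0 ≤ᵐ[μ] fun x => g x + K := by
    filter_upwards [ae_all_iff.2 hK, hfg] with x hx hl
    have := ge_of_tendsto' hl hx
    simp only [Pi.zero_apply]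
    linarith
  have hc0 : 0 ≤ c + M := by
    refine ge_of_tendsto' (hbc.add_const M) fun n => ?_
    have := integral_nonneg_of_ae (hf0 n)
    rw [hadd _ (hf n)] at this
    linarith [hb n]
  have key : ENNReal.ofReal (∫ x, (g x + K) ∂μ) ≤ ENNReal.ofReal (c + M) := by
    rw [ofReal_integral_eq_lintegral_ofReal (f := fun x => g x + K)
      (hg.add (integrable_const K)) hg0]
    calc ∫⁻ x, ENNReal.ofReal (g x + K) ∂μ
        = ∫⁻ x, liminf (fun n => ENNReal.ofReal (f n x + K)) atTop ∂μ := by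
          refine lintegral_congr_ae ?_
          filter_upwards [hfg] with x hx
          exact ((ENNReal.continuous_ofReal.tendsto _).comp (hx.add_const K)).liminf_eq.symm
      _ ≤ liminf (fun n => ∫⁻ x, ENNReal.ofReal (f n x + K) ∂μ) atTop :=
          lintegral_liminf_le' fun n =>
            ((hf n).1.aemeasurable.add_const K).ennreal_ofReal
      _ ≤ liminf (fun n => ENNReal.ofReal (b n + M)) atTop := by
          refine liminf_le_liminf (Eventually.of_forall fun n => ?_)
          rw [← ofReal_integral_eq_lintegral_ofReal (f := fun x => f n x + K)
            ((hf n).add (integrable_const K)) (hf0 n), hadd _ (hf n)]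
          exact ENNReal.ofReal_le_ofReal (by linarith [hb n])
      _ = ENNReal.ofReal (c + M) :=
          ((ENNReal.continuous_ofReal.tendsto _).comp (hbc.add_const M)).liminf_eq
  rw [ENNReal.ofReal_le_ofReal_iff hc0, hadd _ hg] at key
  linarith

/-- `L t` is dominated by `δ t^P`, up to a constant, when `P > 1`. -/
theorem exists_mul_le_rpow_add {P L δ : ℝ} (hP : 1 < P) (hL : 0 ≤ L) (hδ : 0 < δ) :
    ∃ K : ℝ, ∀ t : ℝ, 0 ≤ t → L * t ≤ δ * t ^ P + K := by
  -- The threshold where `δ R^(P-1) = L`: beyond it the power dominates, below it the linear term is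
  -- at most `L R`.
  set R := (L / δ) ^ (P - 1)⁻¹ with hR
  have hR0 : 0 ≤ R := by positivity
  refine ⟨L * R, fun t ht => ?_⟩
  rcases le_or_gt t R with h | h
  · have h1 : L * t ≤ L * R := mul_le_mul_of_nonneg_left h hL
    have h2 : 0 ≤ δ * t ^ P := by positivity
    linarith
  · have h0 : 0 < t := hR0.trans_lt h
    have h1 : L / δ ≤ t ^ (P - 1) := by
      have h2 := Real.rpow_le_rpow hR0 h.le (by linarith : 0 ≤ P - 1)
      rwa [hR, ← Real.rpow_mul (by positivity), inv_mul_cancel₀ (by linarith), Real.rpow_one] at h2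
    have h2 : L ≤ δ * t ^ (P - 1) := by
      rwa [div_le_iff₀ hδ, mul_comm] at h1
    have h3 : L * t ≤ δ * t ^ P := by
      have := mul_le_mul_of_nonneg_right h2 ht
      rwa [Real.rpow_sub_one h0.ne', mul_assoc, div_mul_cancel₀ _ h0.ne'] at this
    have h4 : 0 ≤ L * R := by positivity
    linarith

variable {N : ℕ} {Ω : Compacts (Euc N)}

/-- A linear functional has no sign, so Fatou is applied to a small multiple of `|v|^p` plus `±⟪∇φ,
v⟫`, which is bounded below because `p > 1` and `∇φ` is bounded on `Ω`. The two signs give the two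
inequalities. -/
theorem IsAdmissible.of_tendsto_ae {p q : ℝ≥0∞} [Fact (1 ≤ q)] (hp : 1 < p) (hp' : p < ⊤)
    {T : DualSobolev Ω q} {v : ℕ → Euc N → Euc N} {V : Euc N → Euc N} {B : ℝ}
    (hv : ∀ n, MemLp (v n) p (leb Ω)) (hV : MemLp V p (leb Ω))
    (hB : ∀ n, ∫ x, ‖v n x‖ ^ p.toReal ∂(leb Ω) ≤ B)
    (h : ∀ᵐ x ∂(leb Ω), Tendsto (fun n => v n x) atTop (𝓝 (V x)))
    (hadm : ∀ n, IsAdmissible Ω q T (v n)) : IsAdmissible Ω q T V := by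
  have hP : 1 < p.toReal := by
    simpa using (ENNReal.toReal_lt_toReal ENNReal.one_ne_top hp'.ne).2 hp
  have hp0 : p ≠ 0 := (zero_lt_one.trans hp).ne'
  have hB0 : 0 ≤ B := (integral_nonneg fun x => by positivity).trans (hB 0)
  intro φ hφ
  obtain ⟨L, hL⟩ := Ω.isCompact.exists_bound_of_continuousOn (continuous_gradient hφ).continuousOn
  have hgrad : ∀ᵐ x ∂(leb Ω), ‖∇ φ x‖ ≤ max L 0 := by
    filter_upwards [ae_restrict_mem Ω.isCompact.measurableSet] with x hx
    exact (hL x hx).trans (le_max_left _ _)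
  set τ := T (HomSobolev.ofC1 Ω q φ hφ)
  have i1 : ∀ {w : Euc N → Euc N}, MemLp w p (leb Ω) →
      Integrable (fun x => ‖w x‖ ^ p.toReal) (leb Ω) := fun hw => hw.integrable_norm_rpow hp0 hp'.ne
  have i2 : ∀ {w : Euc N → Euc N}, MemLp w p (leb Ω) →
      Integrable (fun x => ⟪∇ φ x, w x⟫) (leb Ω) := fun hw =>
    integrable_inner_gradient hφ (hw.integrable hp.le)
  have key : ∀ s : ℝ, |s| = 1 → ∀ δ : ℝ, 0 < δ →
      s * ∫ x, ⟪∇ φ x, V x⟫ ∂(leb Ω) ≤ s * τ + δ := by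
    intro s hs δ hδ
    -- This weight makes the added `p`-th power contribute at most `δ` to each integral; the `+ 1`
    -- avoids division by zero.
    have hδ' : 0 < δ / (B + 1) := by positivity
    obtain ⟨K, hK⟩ := exists_mul_le_rpow_add hP (le_max_right L 0) hδ'
    have hsplit : ∀ {w : Euc N → Euc N}, MemLp w p (leb Ω) →
        ∫ x, (δ / (B + 1) * ‖w x‖ ^ p.toReal + s * ⟪∇ φ x, w x⟫) ∂(leb Ω)
          = δ / (B + 1) * ∫ x, ‖w x‖ ^ p.toReal ∂(leb Ω) + s * ∫ x, ⟪∇ φ x, w x⟫ ∂(leb Ω) :=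
      fun hw => by
        rw [integral_add ((i1 hw).const_mul _) ((i2 hw).const_mul _), integral_const_mul,
          integral_const_mul]
    have hmain := integral_le_of_tendsto_ae (μ := leb Ω) (K := K)
      (f := fun n x => δ / (B + 1) * ‖v n x‖ ^ p.toReal + s * ⟪∇ φ x, v n x⟫)
      (g := fun x => δ / (B + 1) * ‖V x‖ ^ p.toReal + s * ⟪∇ φ x, V x⟫)
      (b := fun _ => δ + s * τ) (c := δ + s * τ)
      (fun n => ((i1 (hv n)).const_mul _).add ((i2 (hv n)).const_mul _))
      (((i1 hV).const_mul _).add ((i2 hV).const_mul _))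
      (fun n => by
        filter_upwards [hgrad] with x hx
        have h1 := hK ‖v n x‖ (norm_nonneg _)
        have h2 : |s * ⟪∇ φ x, v n x⟫| ≤ max L 0 * ‖v n x‖ := by
          rw [abs_mul, hs, one_mul]
          exact (abs_real_inner_le_norm _ _).trans
            (mul_le_mul_of_nonneg_right hx (norm_nonneg _))
        have h3 := neg_abs_le (s * ⟪∇ φ x, v n x⟫)
        linarith)
      (by
        filter_upwards [h] with x hx
        have h1 : Tendsto (fun n => ‖v n x‖ ^ p.toReal) atTop (𝓝 (‖V x‖ ^ p.toReal)) :=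
          hx.norm.rpow_const (Or.inr (by linarith))
        exact (h1.const_mul _).add ((tendsto_const_nhds.inner hx).const_mul s))
      (fun n => by
        rw [hsplit (hv n), hadm n φ hφ]
        have h1 : δ / (B + 1) * ∫ x, ‖v n x‖ ^ p.toReal ∂(leb Ω) ≤ δ / (B + 1) * (B + 1) :=
          mul_le_mul_of_nonneg_left (by linarith [hB n]) hδ'.le
        rw [div_mul_cancel₀ _ (by positivity)] at h1
        linarith)
      tendsto_const_nhds
    rw [hsplit hV] at hmain
    have h0 : 0 ≤ δ / (B + 1) * ∫ x, ‖V x‖ ^ p.toReal ∂(leb Ω) :=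
      mul_nonneg hδ'.le (integral_nonneg fun x => by positivity)
    linarith
  refine le_antisymm (le_of_forall_pos_le_add fun δ hδ => ?_)
    (le_of_forall_pos_le_add fun δ hδ => ?_)
  · simpa using key 1 (by simp) δ hδ
  · have := key (-1) (by simp) δ hδ
    linarith

variable {H : Euc N → Euc N → ℝ}

/-- Along simple functions approximating the field, the composite is a finite sum of measurable
pieces; continuity in `z` passes to the limit. -/
theorem IsCaratheodory.aestronglyMeasurable_comp (hcar : IsCaratheodory Ω H)
    {V : Euc N → Euc N} (hV : AEStronglyMeasurable V (leb Ω)) :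
    AEStronglyMeasurable (fun x => H x (V x)) (leb Ω) := by
  obtain ⟨W, hW, hVW⟩ := hV
  have hlim : ∀ᵐ x ∂(leb Ω), Tendsto (fun n => H x (hW.approx n x)) atTop (𝓝 (H x (V x))) := by
    filter_upwards [hcar.2, hVW] with x hx hxe
    rw [hxe]
    exact (hx.tendsto _).comp (hW.tendsto_approx x)
  refine aestronglyMeasurable_of_tendsto_ae _ (fun n => ?_) hlim
  have e : (fun x => H x (hW.approx n x))
      = fun x => ∑ z ∈ (hW.approx n).range, ((hW.approx n) ⁻¹' {z}).indicator (fun x => H x z) x := by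
    ext x
    rw [Finset.sum_eq_single (hW.approx n x)]
    · simp
    · intro z _ hz
      have hx : x ∉ (hW.approx n) ⁻¹' {z} := fun hx => hz (mem_singleton_iff.1 hx).symm
      exact indicator_of_notMem hx _
    · intro hx
      exact absurd (SimpleFunc.mem_range_self _ x) hx
  rw [e]
  exact (Finset.aemeasurable_fun_sum _ fun z _ =>
    (hcar.1 z).indicator ((hW.approx n).measurableSet_fiber z)).aestronglyMeasurable

theorem HasGrowth.integrable {p : ℝ≥0∞} (hcar : IsCaratheodory Ω H)
    (hgrowth : HasGrowth Ω p.toReal H) {V : Euc N → Euc N} (hV : MemLp V p (leb Ω)) :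
    Integrable (fun x => H x (V x)) (leb Ω) := by
  obtain ⟨c, hc0, hc1, hc⟩ := hgrowth
  refine ((hV.integrable_norm_rpow'.add (integrable_const 1)).const_mul (1 / c)).mono'
    (hcar.aestronglyMeasurable_comp hV.1) ?_
  filter_upwards [ae_restrict_mem Ω.isCompact.measurableSet] with x hx
  obtain ⟨h1, h2⟩ := hc x hx (V x)
  refine abs_le.2 ⟨?_, h2⟩
  have h3 : 0 ≤ ‖V x‖ ^ p.toReal := by positivity
  have h4 : 1 ≤ 1 / c := by rw [le_div_iff₀ hc0]; linarith
  change -(1 / c * (‖V x‖ ^ p.toReal + 1)) ≤ H x (V x)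
  nlinarith

theorem IsStrictlyConvexIncreasingInNorm.monotone (hstrict : IsStrictlyConvexIncreasingInNorm Ω H)
    {x : Euc N} (hx : x ∈ Ω) {z w : Euc N} (h : ‖z‖ ≤ ‖w‖) : H x z ≤ H x w := by
  obtain ⟨f, _, hm, hf⟩ := hstrict x hx
  rw [hf, hf]
  exact hm (norm_nonneg z) (norm_nonneg w) h

/-- Strictness comes from the profile `f` when the norms differ and from the roundness of the
Euclidean ball when they agree. -/
theorem IsStrictlyConvexIncreasingInNorm.midpoint_lt
    (hstrict : IsStrictlyConvexIncreasingInNorm Ω H) {x : Euc N} (hx : x ∈ Ω) {a b : Euc N}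
    (hab : a ≠ b) : H x ((2⁻¹ : ℝ) • (a + b)) < (H x a + H x b) / 2 := by
  obtain ⟨f, hs, hm, hf⟩ := hstrict x hx
  rw [hf, hf, hf]
  -- A monotone strictly convex function is strictly monotone: compare `f s` with the value at the
  -- midpoint of `s` and `t`.
  have hsm : StrictMonoOn f (Ici 0) := by
    intro s hs0 t ht0 hst
    have hs1 : (0 : ℝ) ≤ s := hs0
    have ht1 : (0 : ℝ) ≤ t := ht0
    have h1 := hs.2 hs0 ht0 hst.ne (by norm_num : (0 : ℝ) < 2⁻¹) (by norm_num : (0 : ℝ) < 2⁻¹)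
      (by norm_num)
    simp only [smul_eq_mul] at h1
    have h2 : f s ≤ f (2⁻¹ * s + 2⁻¹ * t) :=
      hm hs0 (mem_Ici.2 (by positivity)) (by linarith)
    linarith
  have hn : ‖(2⁻¹ : ℝ) • (a + b)‖ = 2⁻¹ * ‖a + b‖ := by
    rw [norm_smul]
    norm_num
  have htri := norm_add_le a b
  by_cases he : ‖a‖ = ‖b‖
  -- Equal norms: the parallelogram law makes the midpoint strictly shorter.
  · have hlt : ‖(2⁻¹ : ℝ) • (a + b)‖ < ‖a‖ := by
      have hpar := parallelogram_law_with_norm ℝ a b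
      have hpos : 0 < ‖a - b‖ := norm_pos_iff.2 (sub_ne_zero.2 hab)
      rw [hn]
      rw [← he] at hpar
      have h1 : ‖a + b‖ < 2 * ‖a‖ :=
        lt_of_pow_lt_pow_left₀ 2 (by positivity) (by nlinarith)
      linarith
    have := hsm (norm_nonneg _) (norm_nonneg _) hlt
    rw [← he]
    linarith
  · have h1 := hs.2 (norm_nonneg a) (norm_nonneg b) he (by norm_num : (0 : ℝ) < 2⁻¹)
      (by norm_num : (0 : ℝ) < 2⁻¹) (by norm_num)
    simp only [smul_eq_mul] at h1
    have h2 : f ‖(2⁻¹ : ℝ) • (a + b)‖ ≤ f (2⁻¹ * ‖a‖ + 2⁻¹ * ‖b‖) :=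
      hm (norm_nonneg _) (mem_Ici.2 (by positivity)) (by rw [hn]; linarith)
    linarith

/-- The energy is midpoint convex. -/
theorem integral_midpoint_le {p : ℝ≥0∞} (hcar : IsCaratheodory Ω H)
    (hgrowth : HasGrowth Ω p.toReal H) (hconv : ∀ x ∈ Ω, ConvexOn ℝ univ (H x))
    {V W : Euc N → Euc N} (hV : MemLp V p (leb Ω)) (hW : MemLp W p (leb Ω)) :
    ∫ x, H x ((2⁻¹ : ℝ) • (V x + W x)) ∂(leb Ω)
      ≤ (∫ x, H x (V x) ∂(leb Ω) + ∫ x, H x (W x) ∂(leb Ω)) / 2 := by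
  have iV := hgrowth.integrable hcar hV
  have iW := hgrowth.integrable hcar hW
  have iM := hgrowth.integrable hcar ((hV.add hW).const_smul (2⁻¹ : ℝ))
  rw [← integral_add iV iW, ← integral_div]
  refine integral_mono_ae iM ((iV.add iW).div_const 2) ?_
  filter_upwards [ae_restrict_mem Ω.isCompact.measurableSet] with x hx
  have := (hconv x hx).2 (mem_univ (V x)) (mem_univ (W x)) (by norm_num : (0 : ℝ) ≤ 2⁻¹)
    (by norm_num : (0 : ℝ) ≤ 2⁻¹) (by norm_num)
  simp only [smul_eq_mul, ← smul_add] at this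
  change H x ((2⁻¹ : ℝ) • (V x + W x)) ≤ (H x (V x) + H x (W x)) / 2
  linarith

/-- The pointwise midpoint gap is nonnegative, and the hypothesis forces its integral to vanish; it
is then zero a.e., which by strict convexity happens only where `V = W`. -/
theorem ae_eq_of_integral_le_integral_midpoint {p : ℝ≥0∞} (hcar : IsCaratheodory Ω H)
    (hgrowth : HasGrowth Ω p.toReal H) (hstrict : IsStrictlyConvexIncreasingInNorm Ω H)
    {V W : Euc N → Euc N} (hV : MemLp V p (leb Ω)) (hW : MemLp W p (leb Ω))
    (hle : (∫ x, H x (V x) ∂(leb Ω) + ∫ x, H x (W x) ∂(leb Ω)) / 2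
      ≤ ∫ x, H x ((2⁻¹ : ℝ) • (V x + W x)) ∂(leb Ω)) : V =ᵐ[leb Ω] W := by
  have iV := hgrowth.integrable hcar hV
  have iW := hgrowth.integrable hcar hW
  have iM : Integrable (fun x => H x ((2⁻¹ : ℝ) • (V x + W x))) (leb Ω) :=
    hgrowth.integrable hcar ((hV.add hW).const_smul (2⁻¹ : ℝ))
  have iVW : Integrable (fun x => (H x (V x) + H x (W x)) / 2) (leb Ω) := (iV.add iW).div_const 2
  have hmem := ae_restrict_mem (μ := volume) Ω.isCompact.measurableSet
  have hnn : 0 ≤ᵐ[leb Ω] fun x =>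
      (H x (V x) + H x (W x)) / 2 - H x ((2⁻¹ : ℝ) • (V x + W x)) := by
    filter_upwards [hmem] with x hx
    by_cases h : V x = W x
    · have e : (2⁻¹ : ℝ) • (W x + W x) = W x := by
        rw [← two_smul ℝ, smul_smul, inv_mul_cancel₀ two_ne_zero, one_smul]
      rw [Pi.zero_apply, h, e]
      linarith
    · exact sub_nonneg.2 (hstrict.midpoint_lt hx h).le
  have hzero : ∫ x, ((H x (V x) + H x (W x)) / 2 - H x ((2⁻¹ : ℝ) • (V x + W x))) ∂(leb Ω) = 0 := by
    refine le_antisymm ?_ (integral_nonneg_of_ae hnn)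
    rw [integral_sub iVW iM, integral_div, integral_add iV iW]
    linarith
  rw [integral_eq_zero_iff_of_nonneg_ae hnn (iVW.sub iM)] at hzero
  filter_upwards [hzero, hmem] with x h0 hx
  by_contra h
  have := hstrict.midpoint_lt hx h
  rw [Pi.zero_apply] at h0
  linarith

theorem exists_minimizer {p q : ℝ≥0∞} [Fact (1 ≤ q)] (hp : 1 < p) (hp' : p < ⊤)
    (hpq : p.HolderConjugate q) (hcar : IsCaratheodory Ω H)
    (hconv : ∀ x ∈ Ω, ConvexOn ℝ univ (H x)) (hgrowth : HasGrowth Ω p.toReal H)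
    (T : DualSobolev Ω q) :
    ∃ V : Euc N → Euc N, MemLp V p (leb Ω) ∧ IsAdmissible Ω q T V ∧
      ∀ W, MemLp W p (leb Ω) → IsAdmissible Ω q T W →
        ∫ x, H x (V x) ∂(leb Ω) ≤ ∫ x, H x (W x) ∂(leb Ω) := by
  have hP : 1 < p.toReal := by
    simpa using (ENNReal.toReal_lt_toReal ENNReal.one_ne_top hp'.ne).2 hp
  have hp0 : p ≠ 0 := (zero_lt_one.trans hp).ne'
  have hmem := ae_restrict_mem (μ := volume) Ω.isCompact.measurableSet
  obtain ⟨c, hc0, hc1, hc⟩ := id hgrowth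
  set M := (leb Ω).real univ with hM
  let E : (Euc N → Euc N) → ℝ := fun V => ∫ x, H x (V x) ∂(leb Ω)
  let A : Set (Euc N → Euc N) := {V | MemLp V p (leb Ω) ∧ IsAdmissible Ω q T V}
  have hcoer : ∀ V, MemLp V p (leb Ω) → c * ((∫ x, ‖V x‖ ^ p.toReal ∂(leb Ω)) - M) ≤ E V := by
    intro V hV
    have iV : Integrable (fun x => ‖V x‖ ^ p.toReal) (leb Ω) := hV.integrable_norm_rpow'
    have h1 : ∫ x, c * (‖V x‖ ^ p.toReal - 1) ∂(leb Ω) ≤ E V := by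
      refine integral_mono_ae ((iV.sub (integrable_const 1)).const_mul c)
        (hgrowth.integrable hcar hV) ?_
      filter_upwards [hmem] with x hx using (hc x hx (V x)).1
    rw [integral_const_mul, integral_sub iV (integrable_const 1), integral_const, smul_eq_mul,
      mul_one] at h1
    exact h1
  have hbdd : BddBelow (E '' A) := by
    refine ⟨-(c * M), ?_⟩
    rintro _ ⟨V, hV, rfl⟩
    have h1 := hcoer V hV.1
    have h2 : 0 ≤ c * ∫ x, ‖V x‖ ^ p.toReal ∂(leb Ω) :=
      mul_nonneg hc0.le (integral_nonneg fun x => by positivity)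
    linarith
  have hAne : A.Nonempty := by
    obtain ⟨V, hV⟩ := exists_isAdmissible hp hp' hpq T
    exact ⟨V, Lp.memLp V, hV⟩
  set m := sInf (E '' A) with hm
  have hmle : ∀ V ∈ A, m ≤ E V := fun V hV => csInf_le hbdd ⟨V, hV, rfl⟩
  let ε : ℕ → ℝ := fun n => 1 / ((n : ℝ) + 1)
  have hε0 : ∀ n, 0 < ε n := fun n => by positivity
  have hεanti : Antitone ε := fun _ _ h => one_div_le_one_div_of_le (by positivity) (by gcongr)
  have hε : Tendsto ε atTop (𝓝 0) := tendsto_one_div_add_atTop_nhds_zero_nat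
  -- Near-minimizers at level `ε n`: nested, nonempty, and stable under midpoints by convexity of
  -- the energy.
  let C : ℕ → Set (Euc N → Euc N) := fun n => {V | V ∈ A ∧ E V ≤ m + ε n}
  -- Solve the coercivity bound `c (∫ |V|^p - M) ≤ E V ≤ m + 1`, valid since `ε n ≤ 1`.
  set B := (m + 1) / c + M with hB
  have hCB : ∀ n, ∀ V ∈ C n, ∫ x, ‖V x‖ ^ p.toReal ∂(leb Ω) ≤ B := by
    intro n V hV
    have h1 := hcoer V hV.1.1
    have h2 : ε n ≤ 1 := by simpa [ε] using hεanti (Nat.zero_le n)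
    have h3 := hV.2
    rw [hB, ← sub_le_iff_le_add, le_div_iff₀ hc0]
    linarith
  have hint : ∀ V ∈ A, Integrable V (leb Ω) := fun V hV => hV.1.integrable hp.le
  -- The `L¹` bound `M + B` integrates `t ≤ 1 + t^p`.
  obtain ⟨v, hvC, V, hV⟩ := exists_mem_ae_tendsto (μ := leb Ω) (C := C) (B := M + B)
    (fun i j hij V hV => ⟨hV.1, hV.2.trans (by linarith [hεanti hij])⟩)
    (fun n => by
      obtain ⟨_, ⟨V, hV, rfl⟩, hlt⟩ := exists_lt_of_csInf_lt (hAne.image E)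
        (lt_add_of_pos_right m (hε0 n))
      exact ⟨V, hV, hlt.le⟩)
    (fun n V hV W hW => ⟨⟨(hV.1.1.add hW.1.1).const_smul (2⁻¹ : ℝ),
      IsAdmissible.midpoint (hint V hV.1) (hint W hW.1) hV.1.2 hW.1.2⟩, by
        have h1 := integral_midpoint_le hcar hgrowth hconv hV.1.1 hW.1.1
        have h2 := hV.2
        have h3 := hW.2
        change ∫ x, H x ((2⁻¹ : ℝ) • (V x + W x)) ∂(leb Ω) ≤ m + ε n
        change ∫ x, H x (V x) ∂(leb Ω) ≤ m + ε n at h2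
        change ∫ x, H x (W x) ∂(leb Ω) ≤ m + ε n at h3
        linarith⟩)
    (fun V hV => hint V hV.1)
    (fun V hV => by
      have iV : Integrable (fun x => ‖V x‖ ^ p.toReal) (leb Ω) := hV.1.1.integrable_norm_rpow'
      have h1 : ∫ x, ‖V x‖ ∂(leb Ω) ≤ ∫ x, (1 + ‖V x‖ ^ p.toReal) ∂(leb Ω) := by
        refine integral_mono (hint V hV.1).norm ((integrable_const 1).add iV) fun x => ?_
        change ‖V x‖ ≤ 1 + ‖V x‖ ^ p.toReal
        rcases le_total ‖V x‖ 1 with h | h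
        · have : 0 ≤ ‖V x‖ ^ p.toReal := by positivity
          linarith
        · have := Real.self_le_rpow_of_one_le h hP.le
          linarith
      rw [integral_add (integrable_const 1) iV, integral_const, smul_eq_mul, mul_one] at h1
      linarith [hCB 0 V hV])
  have hvm : ∀ n, MemLp (v n) p (leb Ω) := fun n => (hvC n).1.1
  have hvB := fun n => hCB n (v n) (hvC n)
  have hVm := (memLp_of_tendsto_ae_of_integral_rpow_le hp0 hp'.ne hvm hvB hV).1
  have hVadm : IsAdmissible Ω q T V :=
    IsAdmissible.of_tendsto_ae hp hp' hvm hVm hvB hV fun n => (hvC n).1.2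
  refine ⟨V, hVm, hVadm, fun W hW hWadm => le_trans ?_ (hmle W ⟨hW, hWadm⟩)⟩
  -- The growth condition bounds the integrand below by `-c`.
  refine integral_le_of_tendsto_ae (K := c) (b := fun n => m + ε n)
    (fun n => hgrowth.integrable hcar (hvm n)) (hgrowth.integrable hcar hVm) (fun n => ?_) ?_
    (fun n => (hvC n).2) (by simpa using hε.const_add m)
  · filter_upwards [hmem] with x hx
    have h1 := (hc x hx (v n x)).1
    have h2 : 0 ≤ c * ‖v n x‖ ^ p.toReal := by positivity
    linarith
  · filter_upwards [hcar.2, hV] with x h1 h2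
    exact (h1.tendsto _).comp h2

end Energy

end Beckmann

/-! ### Existence, uniqueness and acyclicity of the minimizer. -/

theorem proposition2p7 {N : ℕ} (Ω : Compacts (Beckmann.Euc N))
    (hΩ : Beckmann.IsClosedSmoothDomain (Ω : Set (Beckmann.Euc N)))
    (p q : ℝ≥0∞) [Fact (1 ≤ q)] (hp : 1 < p) (hp' : p < ⊤) (hpq : p.HolderConjugate q)
    (H : Beckmann.Euc N → Beckmann.Euc N → ℝ)
    (hcar : Beckmann.IsCaratheodory Ω H)
    (hconv : ∀ x ∈ Ω, ConvexOn ℝ Set.univ (H x))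
    (hgrowth : Beckmann.HasGrowth Ω p.toReal H)
    (hstrict : Beckmann.IsStrictlyConvexIncreasingInNorm Ω H)
    (T : Beckmann.DualSobolev Ω q) :
    ∃ V : Lp (Beckmann.Euc N) p (Beckmann.leb Ω),
      Beckmann.IsBeckmannMinimizer Ω p q H T V ∧
      (∀ W : Lp (Beckmann.Euc N) p (Beckmann.leb Ω),
        Beckmann.IsBeckmannMinimizer Ω p q H T W → W = V) ∧
      Beckmann.IsAcyclic Ω V := by
  obtain ⟨V₀, hV₀, hV₀adm, hV₀min⟩ :=
    Beckmann.exists_minimizer hp hp' hpq hcar hconv hgrowth T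
  set V : Lp (Beckmann.Euc N) p (Beckmann.leb Ω) := hV₀.toLp V₀ with hVdef
  have hVae : V =ᵐ[Beckmann.leb Ω] V₀ := hV₀.coeFn_toLp
  have hVadm : Beckmann.IsAdmissible Ω q T V := Beckmann.isAdmissible_congr hVae.symm hV₀adm
  have hVint : Integrable V (Beckmann.leb Ω) := (Lp.memLp V).integrable hp.le
  have hE : ∫ x, H x (V x) ∂(Beckmann.leb Ω) = ∫ x, H x (V₀ x) ∂(Beckmann.leb Ω) := by
    refine integral_congr_ae ?_
    filter_upwards [hVae] with x hx
    rw [hx]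
  have hVmin : ∀ W, MemLp W p (Beckmann.leb Ω) → Beckmann.IsAdmissible Ω q T W →
      ∫ x, H x (V x) ∂(Beckmann.leb Ω) ≤ ∫ x, H x (W x) ∂(Beckmann.leb Ω) :=
    fun W hW hWadm => hE.trans_le (hV₀min W hW hWadm)
  -- Any admissible competitor with energy at most that of `V` equals `V`: the midpoint is
  -- admissible, so its energy is at least the minimum. This serves both uniqueness and acyclicity.
  have huniq : ∀ W, MemLp W p (Beckmann.leb Ω) → Beckmann.IsAdmissible Ω q T W →
      ∫ x, H x (W x) ∂(Beckmann.leb Ω) ≤ ∫ x, H x (V x) ∂(Beckmann.leb Ω) →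
      W =ᵐ[Beckmann.leb Ω] V := by
    intro W hW hWadm hle
    refine Beckmann.ae_eq_of_integral_le_integral_midpoint hcar hgrowth hstrict hW (Lp.memLp V) ?_
    have := hVmin _ ((hW.add (Lp.memLp V)).const_smul (2⁻¹ : ℝ))
      (hWadm.midpoint (hW.integrable hp.le) hVint hVadm)
    refine le_trans ?_ this
    linarith
  refine ⟨V, ⟨hVadm, hgrowth.integrable hcar (Lp.memLp V),
    fun W hW => hVmin W (Lp.memLp W) hW⟩, fun W hW => Lp.ext ?_, hVint, ?_⟩
  · exact huniq W (Lp.memLp W) hW.1 (hW.2.2 V hVadm)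
  · intro V₁ V₂ h₁ h₂ hsum hnorm hdiv
    -- `V₂` is given only in `L¹`, but `|V₂| ≤ |V|` places it in `L^p`, making it a legitimate
    -- competitor.
    have hV₂m : MemLp V₂ p (Beckmann.leb Ω) := by
      refine (Lp.memLp V).mono h₂.1 ?_
      filter_upwards [hnorm] with x hx
      rw [hx]
      exact le_add_of_nonneg_left (norm_nonneg _)
    have hV₂adm : Beckmann.IsAdmissible Ω q T V₂ := by
      intro φ hφ
      have e : ∫ x, ⟪∇ φ x, V x⟫ ∂(Beckmann.leb Ω)
          = ∫ x, (⟪∇ φ x, V₁ x⟫ + ⟪∇ φ x, V₂ x⟫) ∂(Beckmann.leb Ω) := by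
        refine integral_congr_ae ?_
        filter_upwards [hsum] with x hx
        rw [hx, inner_add_right]
      have hdiv' : ∫ x, ⟪∇ φ x, V₁ x⟫ ∂(Beckmann.leb Ω) = 0 := by
        simpa only [real_inner_comm] using hdiv φ hφ
      rw [← hVadm φ hφ, e, integral_add (Beckmann.integrable_inner_gradient hφ h₁)
        (Beckmann.integrable_inner_gradient hφ h₂), hdiv', zero_add]
    have hEle : ∫ x, H x (V₂ x) ∂(Beckmann.leb Ω) ≤ ∫ x, H x (V x) ∂(Beckmann.leb Ω) := by
      refine integral_mono_ae (hgrowth.integrable hcar hV₂m)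
        (hgrowth.integrable hcar (Lp.memLp V)) ?_
      filter_upwards [hnorm, ae_restrict_mem Ω.isCompact.measurableSet] with x hx hxΩ
      refine hstrict.monotone hxΩ ?_
      rw [hx]
      exact le_add_of_nonneg_left (norm_nonneg _)
    -- Now `V₂ = V` a.e., so `V = V₁ + V₂` leaves `V₁ = 0`.
    filter_upwards [huniq V₂ hV₂m hV₂adm hEle, hsum] with x e1 e2
    rw [e1] at e2
    exact left_eq_add.1 (e2.trans (add_comm _ _))
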